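/- Let $X=\{0,1\}^{\mathbb N}$ with its product $\sigma$-algebra and the standard (fair coin) product probability measure $\mu$. **Definitions.** Let $G$ be a group with a sequence of generators $\gamma_1,\gamma_2,\dots$. For an action $\theta$ of $G$ on a set $Y$ whose points are labeled by elements of $\{0,1\}^{\mathbb N}$ (a point of $X$ being its own label), the *$r$-labeled $r$-neighborhood* of $x\in Y$ is the multigraph spanned by the points $\theta(w,x)$, where $w$ runs over the words of length at most $r$ in $\gamma_1^{\pm1},\dots,\gamma_r^{\pm1}$, rooted at $x$, with an edge of color $\gamma_i$ from $y$ to $\theta(\gamma_i,y)$ (equivalently, an edge of color $\gamma_i^{-1}$ back) for all $i\le r$, and with every vertex labeled by the first $r$ digits of its label. Let $U^{r,r}$ be the finite set of the isomorphism types of rooted multigraphs with edges colored in this way and vertices labeled by $\{0,1\}^r$, in which out-edges of a vertex have different colors and every vertex is joined to the root by a path of length at most $r$. For $\alpha\in U^{r,r}$ let $T(\theta,\alpha)$ be the set of points whose $r$-labeled $r$-neighborhood is of type $\alpha$, and put $p_\alpha(\theta)=\mu(T(\theta,\alpha))$ if $Y=X$, and $p_\alpha(\theta)=|T(\theta,\alpha)|/|Y|$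 if $Y$ is finite and nonempty. A Borel action $\theta$ of $G$ on $X$ is *sofic* if there are actions $\theta_n$ of $G$ on finite nonempty labeled sets such that $\lim_{n\to\infty}p_\alpha(\theta_n)=p_\alpha(\theta)$ for all $r\ge1$ and all $\alpha\in U^{r,r}$. An equivalence relation on $X$ is *sofic* if it is the orbit equivalence relation of a $\mu$-preserving sofic Borel action of the free group $\mathbb F_\infty=\langle\gamma_1,\gamma_2,\dots\rangle$. A sequence $S_1,S_2,\dots$ of $\mu$-preserving Borel involutions of $X$ (they may have fixed points, and may be the identity) *generates a treeing* if, for almost every $x\in X$, the connected component of $x$ in the simple graph on $X$ with the edges $\{y,S_iy\}$, $S_iy\ne y$, is a tree. An equivalence relation $E$ on $X$ is *treeable* if there is such a sequence for which the $E$-classes are the connected components of this graph. **Theorem.** 1. If the $\mu$-preserving Borel involutions $S_1,S_2,\dots$ generate a treeing, then the action of $\Gamma=\langle\gamma_1,\gamma_2,\dots\mid\gamma_i^2=1\ (i=1,2,\dots)\rangle$ on $X$ given by $\theta(\gamma_i,x)=S_i(x)$ is sofic. 2. Every treeable equivalence relation on $X$ is sofic. 3. Let $F$ be the free group on a countable (finite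 or infinite) set, with its free generators enumerated by some of the indices $1,2,\dots$, and put $\gamma_n=1$ for the other indices $n$. Then every $\mu$-preserving Borel action of $F$ on $X$ that is essentially free (almost every point has trivial stabilizer) is sofic, and its orbit equivalence relation is sofic. -/

import Mathlib

open MeasureTheory Filter Topology

/-- The Cantor space `{0,1}^ℕ`, with its product σ-algebra. -/
abbrev Cantor : Type := ℕ → Bool

/-- The standard product (fair coin) probability measure on `{0,1}^ℕ`. -/
noncomputable def coinMeasure : Measure Cantor :=
  Measure.infinitePi fun _ : ℕ => (PMF.uniformOfFintype Bool).toMeasure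

/-- `r`-labeled `r`-neighborhoods: rooted multigraphs with edges colored by the `r` generators
(loops and several edges of different colors between two vertices are allowed), all of whose
vertices can be reached from the root by a path of at most `r` edges, and with vertices labeled
by words of length `r`. `edge i v w` says that there is an edge from `v` to `w` with the color of
the `i`-th generator; this is the same as an edge from `w` to `v` with the color of the inverse of
the `i`-th generator, so `out_unique` and `in_unique` say that the out-edges of a vertex have
different colors. -/
structure LabeledNbhd (r : ℕ) where
  V : Type
  root : V
  edge : Fin r → V → V → Prop
  label : V → Fin r → Bool
  out_unique : ∀ i v w w', edge i v w → edge i v w' → w = w'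
  in_unique : ∀ i v v' w, edge i v w → edge i v' w → v = v'
  reach : ∀ v, ∃ n ≤ r, ∃ p : ℕ → V, p 0 = root ∧ p n = v ∧
    ∀ k < n, ∃ i, edge i (p k) (p (k + 1)) ∨ edge i (p (k + 1)) (p k)

/-- Isomorphism of `r`-labeled `r`-neighborhoods: a bijection of the vertices that respects the
root, the colored edges and the labels. -/
def LabeledNbhd.Iso {r : ℕ} (α β : LabeledNbhd r) : Prop :=
  ∃ f : α.V ≃ β.V, f α.root = β.root ∧ (∀ i v w, α.edge i v w ↔ β.edge i (f v) (f w)) ∧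
    ∀ v, α.label v = β.label (f v)

section Action

variable {G : Type*} [Group G]

/-- The set of the elements of `G` that are given by words of length at most `r` in the first `r`
members of the sequence `γ` and their inverses. -/
def wordBall (γ : ℕ → G) (r : ℕ) : Set G :=
  {w | ∃ l : List G, l.length ≤ r ∧ (∀ s ∈ l, ∃ i < r, s = γ i ∨ s = (γ i)⁻¹) ∧ l.prod = w}

/-- The `r`-labeled `r`-neighborhood of a point `x`, for an action `θ` of the group `G`
(with the generators `γ`) on a set whose points are labeled by elements of `{0,1}^ℕ`:
the subgraph spanned by the points `θ w x`, for `w` in `wordBall γ r`, with the edges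
`y → θ (γ i) y`, `i < r`, and with the first `r` digits of the labels. -/
def nbhd (γ : ℕ → G) {Y : Type} (θ : G →* Equiv.Perm Y) (lab : Y → Cantor) (r : ℕ) (x : Y) :
    LabeledNbhd r where
  V := {y : Y // ∃ w ∈ wordBall γ r, θ w x = y}
  root := ⟨x, 1, ⟨[], by simp, by simp, rfl⟩, by simp⟩
  edge i y z := θ (γ i) y.1 = z.1
  label y k := lab y.1 k
  out_unique := fun i v w w' h h' => Subtype.ext (h.symm.trans h')
  in_unique := fun i v v' w h h' => Subtype.ext ((θ (γ i)).injective (h.trans h'.symm))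
  reach := by
    rintro ⟨y, w, ⟨l, hl, hs, rfl⟩, rfl⟩
    refine ⟨l.length, hl, fun k => ⟨θ (l.drop (l.length - k)).prod x, _,
      ⟨l.drop (l.length - k), ?_, fun s h => hs s (List.mem_of_mem_drop h), rfl⟩, rfl⟩, ?_, ?_, ?_⟩
    · exact (List.drop_sublist _ _).length_le.trans hl
    · simp
    · simp
    · intro k hk
      have hlt : l.length - (k + 1) < l.length := by omega
      have hd : l.drop (l.length - (k + 1)) =
          l[l.length - (k + 1)] :: l.drop (l.length - k) := by
        rw [List.drop_eq_getElem_cons hlt]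
        congr 2
        omega
      obtain ⟨i, hi, h⟩ := hs _ (List.getElem_mem hlt)
      refine ⟨⟨i, hi⟩, ?_⟩
      rcases h with h | h
      · left
        simp only [hd, h, List.prod_cons, map_mul, Equiv.Perm.mul_apply]
      · right
        simp only [hd, h, List.prod_cons, map_mul, Equiv.Perm.mul_apply, map_inv]
        exact (θ (γ i)).apply_symm_apply _

/-- `T(θ, α)`: the set of the points whose `r`-labeled `r`-neighborhood is isomorphic to `α`. -/
def typeSet (γ : ℕ → G) {Y : Type} (θ : G →* Equiv.Perm Y) (lab : Y → Cantor) {r : ℕ}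
    (α : LabeledNbhd r) : Set Y :=
  {x | (nbhd γ θ lab r x).Iso α}

/-- A finite nonempty set with an action of `G` and with points labeled by elements of
`{0,1}^ℕ`. -/
structure FiniteLabeledAction (G : Type*) [Group G] where
  Y : Type
  [finite : Finite Y]
  [nonempty : Nonempty Y]
  action : G →* Equiv.Perm Y
  label : Y → Cantor

/-- An action `θ` of the group `G`, with the sequence of generators `γ`, on `({0,1}^ℕ, μ)` is
sofic if there is a sequence of actions of `G` on finite labeled sets such that, for all
`r ≥ 1` and all `r`-labeled `r`-neighborhoods `α`, the proportion of the points of type `α`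
converges to the measure of the set of the points of type `α` for `θ`. -/
def IsSoficAction (μ : Measure Cantor) (γ : ℕ → G) (θ : G →* Equiv.Perm Cantor) : Prop :=
  ∃ A : ℕ → FiniteLabeledAction G, ∀ r : ℕ, 1 ≤ r → ∀ α : LabeledNbhd r,
    Tendsto
      (fun n => ((typeSet γ (A n).action (A n).label α).ncard : ℝ) / (Nat.card (A n).Y : ℝ))
      atTop (𝓝 (μ.real (typeSet γ θ id α)))

/-- The orbit equivalence relation of an action. -/
def orbitSetoid {Y : Type*} (θ : G →* Equiv.Perm Y) : Setoid Y where
  r x y := ∃ g, θ g x = y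
  iseqv :=
    { refl := fun x => ⟨1, by simp⟩
      symm := by
        rintro x y ⟨g, rfl⟩
        exact ⟨g⁻¹, by simp⟩
      trans := by
        rintro x y z ⟨g, rfl⟩ ⟨h, rfl⟩
        exact ⟨h * g, by simp⟩ }

end Action

/-- An equivalence relation on `({0,1}^ℕ, μ)` is sofic if it is the orbit equivalence relation of
a measure-preserving sofic action of the free group on countably many generators. -/
def IsSoficRelation (μ : Measure Cantor) (E : Setoid Cantor) : Prop :=
  ∃ θ : FreeGroup ℕ →* Equiv.Perm Cantor, (∀ g, MeasurePreserving (θ g) μ μ) ∧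
    E = orbitSetoid θ ∧ IsSoficAction μ FreeGroup.of θ

/-- The group `⟨γ₀, γ₁, … | γᵢ² = 1⟩`, the free product of countably many copies of `ℤ/2`. -/
abbrev InvolutionGroup : Type :=
  PresentedGroup (Set.range fun i : ℕ => FreeGroup.of i ^ 2)

/-- The generator `γᵢ` of `⟨γ₀, γ₁, … | γᵢ² = 1⟩`. -/
def involutionGen (i : ℕ) : InvolutionGroup := PresentedGroup.of i

/-- The action of `⟨γ₀, γ₁, … | γᵢ² = 1⟩` in which `γᵢ` acts as the involution `S i`. -/
def involutionAction {Y : Type*} (S : ℕ → Equiv.Perm Y) (hS : ∀ i x, S i (S i x) = x) :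
    InvolutionGroup →* Equiv.Perm Y :=
  PresentedGroup.toGroup (f := S) (by
    rintro _ ⟨i, rfl⟩
    ext x
    simp [pow_two, hS])

/-- The (simple, undirected) graph with the edges `{x, S i x}`, where `S i x ≠ x`. -/
def graphing {Y : Type*} (S : ℕ → Equiv.Perm Y) : SimpleGraph Y :=
  SimpleGraph.fromRel fun x y => ∃ i, S i x = y

/-- The sequence `S` of measure-preserving Borel involutions generates a treeing: almost every
connected component of the graph with the edges `{x, S i x}` is a tree. (An involution may have
fixed points, and it may be the identity, so finite sequences are included.) -/
structure IsTreeing (μ : Measure Cantor) (S : ℕ → Equiv.Perm Cantor) : Prop where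
  measurePreserving : ∀ i, MeasurePreserving (S i) μ μ
  involutive : ∀ i x, S i (S i x) = x
  tree : ∀ᵐ x ∂μ, ((graphing S).connectedComponentMk x).toSimpleGraph.IsTree

/-- An equivalence relation is treeable if it has a treeing generated by measure-preserving
involutions. -/
def IsTreeable (μ : Measure Cantor) (E : Setoid Cantor) : Prop :=
  ∃ S : ℕ → Equiv.Perm Cantor, IsTreeing μ S ∧ E = (graphing S).reachableSetoid

/-- The free generators of a free group on a countable set `ι`, as a sequence: the `n`-th member
is the generator with the number `n`, and it is `1` if there is no such generator. -/
def freeGen (ι : Type*) [Encodable ι] (n : ℕ) : FreeGroup ι :=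
  ((Encodable.decode₂ ι n).map FreeGroup.of).getD 1

/-!
Both kinds of actions are handled by the same finite models. Fix `n` generators and a radius `R`.
The relevant edges of the graph of the action are given by finitely many measure-preserving maps
`T j`, in inverse pairs, such that almost every point is acyclic: no reduced word in the letters `j`
whose letters all move the point along the way leads back to it. For an essentially free action of a
free group the `T j` are the generators and their inverses. For a treeing they are the involutions
`leastColor`, in which every edge of the graph has kept only its least color; then a reduced path
does not backtrack, and it cannot be closed in a tree.

A point `x` has a state in a finite set, which records some digits of `x` and what is needed to
recover the action of the generators from the `T j`. The states seen along the words of length at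
most `R` give a finite measurable partition `P`. The numbers `μ {P = a, P ∘ T j = b}` satisfy
rational linear equations expressing that the `T j` preserve `μ`. A `ℚ`-linear map `ℝ → ℚ` that moves
these finitely many numbers only a little (`exists_rat_linearMap_near`) turns them into nonnegative
rationals with the same equations, hence, after multiplication by a common denominator, into numbers
of points of a finite set, on which maps `t j` with the right transitions can be defined by
matching (`exists_finite_matching`). Short cycles of this finite set are destroyed by passing to its
product with a finite group in which short reduced words are nontrivial
(`exists_finite_group_reduced_ne_one`); a letter that should fix a point acts trivially on both
coordinates (`exists_finite_model`).

If two acyclic points see the same states along all short words, then the same pairs of short words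
lead to equal points: a word can be shortened simultaneously at both points until it is reduced and
moving, and then it is closed only if it is empty (`SameStates.wordAct_eq_self_iff`). Therefore the
two neighborhoods are isomorphic (`SameStates.nbhd_iso`), and the statistics of neighborhoods of the
finite model approximate those of the action (`exists_finite_approximation`). The statements on
equivalence relations follow by letting the free group act through the given group, which does not
change neighborhoods.
-/

/-! ### Rational approximation of finitely many real numbers -/

/-- Finitely many nonnegative reals can be replaced by nonnegative rationals close to them in such
a way that all linear relations with rational coefficients between them persist. The map is defined
on a Hamel basis of `ℝ` over `ℚ` containing `1`, by rounding the basis vectors to rationals. -/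
theorem exists_rat_linearMap_near (s : Finset ℝ) (hs : ∀ v ∈ s, 0 ≤ v) {ε : ℝ} (hε : 0 < ε) :
    ∃ φ : ℝ →ₗ[ℚ] ℚ, φ 1 = 1 ∧ ∀ v ∈ s, |(φ v : ℝ) - v| < ε ∧ 0 ≤ φ v := by
  have hli : LinearIndepOn ℚ id ({1} : Set ℝ) := LinearIndepOn.singleton (by simp)
  set B := Module.Basis.extend hli
  have hBs : ∀ b, B b = b := fun b => Module.Basis.extend_apply_self hli b
  obtain ⟨δ, ⟨hδε, hδs⟩, hδ⟩ : ∃ δ : ℝ, (δ ≤ ε ∧ ∀ v ∈ s, 0 < v → δ ≤ v) ∧ 0 < δ := by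
    have h : ∀ᶠ δ in 𝓝[>] (0 : ℝ), δ ≤ ε ∧ ∀ v ∈ s, 0 < v → δ ≤ v := by
      refine Filter.Eventually.and ?_ ((Filter.eventually_all_finset s).2 fun v _ => ?_)
      · exact nhdsWithin_le_nhds (eventually_le_nhds hε)
      · by_cases hv : 0 < v
        · filter_upwards [nhdsWithin_le_nhds (eventually_le_nhds hv)] with δ h _ using h
        · simp [hv]
    exact (h.and self_mem_nhdsWithin).exists
  obtain ⟨C, hC, hC0⟩ : ∃ C : ℝ, (∀ v ∈ s, ((B.repr v).sum fun _ a => |(a : ℝ)|) ≤ C) ∧ 0 < C := by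
    refine ⟨∑ v ∈ s, ((B.repr v).sum fun _ a => |(a : ℝ)|) + 1, fun v hv => ?_, ?_⟩
    · have := Finset.single_le_sum (f := fun v => ((B.repr v).sum fun _ a => |(a : ℝ)|))
        (fun v _ => Finset.sum_nonneg fun _ _ => abs_nonneg _) hv
      linarith
    · have : 0 ≤ ∑ v ∈ s, ((B.repr v).sum fun _ a => |(a : ℝ)|) :=
        Finset.sum_nonneg fun v _ => Finset.sum_nonneg fun _ _ => abs_nonneg _
      linarith
  have hq : ∀ b : hli.extend (Set.subset_univ _), ∃ q : ℚ,
      |(q : ℝ) - b| ≤ δ / (2 * C) ∧ ((b : ℝ) = 1 → q = 1) := by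
    intro b
    by_cases hb : (b : ℝ) = 1
    · exact ⟨1, by rw [hb]; simp; positivity, fun _ => rfl⟩
    · have hp : 0 < δ / (2 * C) := by positivity
      obtain ⟨q, h1, h2⟩ := exists_rat_btwn (show (b : ℝ) < b + δ / (2 * C) by linarith)
      exact ⟨q, by rw [abs_le]; constructor <;> linarith, fun h => absurd h hb⟩
  choose q hq hq1 using hq
  have hnear : ∀ v ∈ s, |(B.constr ℚ q v : ℝ) - v| < δ := by
    intro v hv
    have h1 : (B.constr ℚ q v : ℝ) = (B.repr v).sum fun b a => (a : ℝ) * q b := by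
      rw [Module.Basis.constr_apply, Finsupp.sum, Finsupp.sum]
      push_cast [smul_eq_mul]
      rfl
    have h2 : v = (B.repr v).sum fun b a => (a : ℝ) * b := by
      conv_lhs => rw [← B.linearCombination_repr v, Finsupp.linearCombination_apply]
      simp only [hBs, Rat.smul_def]
    have h3 : (B.constr ℚ q v : ℝ) - v
        = (B.repr v).sum fun b a => (a : ℝ) * ((q b : ℝ) - b) := by
      rw [h1]
      nth_rewrite 2 [h2]
      simp only [Finsupp.sum, Finset.sum_sub_distrib, mul_sub]
    rw [h3]
    calc |(B.repr v).sum fun b a => (a : ℝ) * ((q b : ℝ) - b)|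
        ≤ (B.repr v).sum fun _ a => |(a : ℝ)| * (δ / (2 * C)) := by
          refine (Finset.abs_sum_le_sum_abs _ _).trans (Finset.sum_le_sum fun b _ => ?_)
          rw [abs_mul]
          exact mul_le_mul_of_nonneg_left (hq b) (abs_nonneg _)
      _ = ((B.repr v).sum fun _ a => |(a : ℝ)|) * (δ / (2 * C)) := by
          rw [Finsupp.sum, Finsupp.sum, Finset.sum_mul]
      _ ≤ C * (δ / (2 * C)) := mul_le_mul_of_nonneg_right (hC v hv) (by positivity)
      _ = δ / 2 := by field_simp
      _ < δ := by linarith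
  refine ⟨B.constr ℚ q, ?_, fun v hv => ⟨(hnear v hv).trans_le hδε, ?_⟩⟩
  · have h1 : (1 : ℝ) ∈ hli.extend (Set.subset_univ _) := hli.subset_extend _ rfl
    have h := B.constr_basis ℚ q ⟨1, h1⟩
    rw [hBs] at h
    rw [h]
    exact hq1 _ rfl
  · rcases (hs v hv).eq_or_lt with h | h
    · rw [← h, map_zero]
    · have h1 := abs_lt.1 (hnear v hv)
      have h2 := hδs v hv h
      have : (0 : ℝ) < (B.constr ℚ q v : ℝ) := by linarith [h1.1]
      exact_mod_cast this.le

/-- The rational numbers of `exists_rat_linearMap_near` have a common denominator. -/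
theorem exists_nat_multiple (φ : ℝ → ℚ) (s : Finset ℝ) (hs : ∀ v ∈ s, 0 ≤ φ v) :
    ∃ D : ℕ, 0 < D ∧ ∃ N : ℝ → ℕ, ∀ v ∈ s, (N v : ℚ) = D * φ v := by
  refine ⟨∏ v ∈ s, (φ v).den, Finset.prod_pos fun v _ => (φ v).pos,
    fun v => (((∏ w ∈ s, (φ w).den : ℕ) : ℚ) * φ v).num.toNat, fun v hv => ?_⟩
  obtain ⟨k, hk⟩ := Finset.dvd_prod_of_mem (fun v => (φ v).den) hv
  have h : ((∏ w ∈ s, (φ w).den : ℕ) : ℚ) * φ v = ((k * (φ v).num : ℤ) : ℚ) := by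
    rw [hk]
    have := Rat.den_mul_eq_num (φ v)
    push_cast
    rw [mul_right_comm, this, mul_comm]
  have h0 : 0 ≤ (k : ℤ) * (φ v).num := mul_nonneg (by positivity) (Rat.num_nonneg.2 (hs v hv))
  have h1 := Int.toNat_of_nonneg h0
  simp only [h, Rat.num_intCast]
  exact_mod_cast congrArg (fun z : ℤ => (z : ℚ)) h1

/-! ### Finite models of a finite partition and finitely many measure-preserving maps -/

/-- If the part `a`, with `n a` points, is to send `m j a b` points to the part `b` under the
`j`-th map, and if these numbers are consistent, then there are such maps, in inverse pairs. -/
theorem exists_matching {K J : Type} [Fintype K] (n : K → ℕ) (m : J → K → K → ℕ)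
    (inv : J → J) (hinv : ∀ j, inv (inv j) = j) (hn : ∀ j a, n a = ∑ b, m j a b)
    (hm : ∀ j a b, m (inv j) b a = m j a b) :
    ∃ t : J → (Σ a, Fin (n a)) → (Σ a, Fin (n a)),
      (∀ j y, t (inv j) (t j y) = y) ∧ ∀ j y, 0 < m j y.1 (t j y).1 := by
  have e : ∀ j a, Fin (n a) ≃ Σ b, Fin (m j a b) := fun j a =>
    Fintype.equivOfCardEq (by simp [hn j a])
  -- the `k`-th point of the part `a` that is to be sent to the part `b` has the code `(a, b, k)`
  let g : J → (Σ a, Fin (n a)) → K × K × ℕ := fun j y =>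
    (y.1, (e j y.1 y.2).1, ((e j y.1 y.2).2 : ℕ))
  have hg : ∀ j, Function.Injective (g j) := by
    rintro j ⟨a, k⟩ ⟨a', k'⟩ h
    simp only [g, Prod.mk.injEq] at h
    obtain ⟨rfl, h1, h2⟩ := h
    have : e j a k = e j a k' := by
      refine Sigma.ext h1 ?_
      rw [Fin.heq_ext_iff (by rw [h1])]
      exact h2
    rw [(e j a).injective this]
  have hsurj : ∀ j a b k, k < m j a b → ∃ y, g j y = (a, b, k) := by
    intro j a b k h
    refine ⟨⟨a, (e j a).symm ⟨b, ⟨k, h⟩⟩⟩, ?_⟩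
    simp only [g]
    rw [Equiv.apply_symm_apply]
  have hlt : ∀ j y, (g j y).2.2 < m j (g j y).1 (g j y).2.1 := fun j y => (e j y.1 y.2).2.isLt
  have ht : ∀ j y, ∃ y', g (inv j) y' = ((g j y).2.1, (g j y).1, (g j y).2.2) := by
    intro j y
    refine hsurj _ _ _ _ ?_
    rw [hm]
    exact hlt j y
  choose t ht using ht
  have ht1 : ∀ j y, (t j y).1 = (g j y).2.1 := fun j y => congrArg Prod.fst (ht j y)
  refine ⟨t, fun j y => hg j ?_, fun j y => ?_⟩
  · have h := ht (inv j) (t j y)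
    rw [hinv, ht] at h
    exact h
  · rw [ht1]
    exact (Nat.zero_le _).trans_lt (hlt j y)

section Matching

variable {X : Type*} [MeasurableSpace X] {K J : Type} [Finite K] [Finite J]

/-- Finite models: for finitely many measure-preserving maps `T j`, in inverse pairs, and a finite
measurable partition `P`, there are a finite set with a partition `p` and with maps `t j`, in inverse
pairs, such that the parts have nearly the right sizes and `t j` takes a point of the part `a` to
a point of the part `b` only if `T j` does so for a set of points of positive measure. The sizes of
the sets `{P = a, P ∘ T j = b}` are replaced by proportional natural numbers without losing the
equations which say that the `T j` preserve the measure, and then the points can be matched. -/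
theorem exists_finite_matching (μ : Measure X) [IsProbabilityMeasure μ] (P : X → K)
    (hP : ∀ a, MeasurableSet (P ⁻¹' {a}))
    (inv : J → J) (hinv : ∀ j, inv (inv j) = j) (T : J → X → X)
    (hT : ∀ j, MeasurePreserving (T j) μ μ) (hTinv : ∀ j x, T (inv j) (T j x) = x)
    {ε : ℝ} (hε : 0 < ε) :
    ∃ (Y : Type) (_ : Finite Y) (_ : Nonempty Y) (p : Y → K) (t : J → Y → Y),
      (∀ j y, t (inv j) (t j y) = y) ∧
      (∀ j y, μ {x | P x = p y ∧ P (T j x) = p (t j y)} ≠ 0) ∧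
      (∀ y, μ {x | P x = p y} ≠ 0) ∧
      ∀ B : Set K, |((p ⁻¹' B).ncard : ℝ) / (Nat.card Y : ℝ) - μ.real (P ⁻¹' B)| < ε := by
  classical
  have := Fintype.ofFinite K
  have := Fintype.ofFinite J
  let v1 : Finset K → ℝ := fun B => μ.real (P ⁻¹' B)
  let v2 : J × K × K → ℝ := fun q => μ.real {x | P x = q.2.1 ∧ P (T q.1 x) = q.2.2}
  have hpair : ∀ j a b, MeasurableSet {x | P x = a ∧ P (T j x) = b} := fun j a b =>
    (hP a).inter ((hT j).measurable (hP b))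
  let s : Finset ℝ := Finset.univ.image v1 ∪ Finset.univ.image v2
  have hs1 : ∀ B, v1 B ∈ s := fun B =>
    Finset.mem_union_left _ (Finset.mem_image_of_mem _ (Finset.mem_univ _))
  have hs2 : ∀ q, v2 q ∈ s := fun q =>
    Finset.mem_union_right _ (Finset.mem_image_of_mem _ (Finset.mem_univ _))
  have hs0 : ∀ v ∈ s, 0 ≤ v := by
    intro v hv
    simp only [s, Finset.mem_union, Finset.mem_image] at hv
    rcases hv with ⟨_, _, rfl⟩ | ⟨_, _, rfl⟩ <;> exact measureReal_nonneg
  obtain ⟨φ, hφ1, hφ⟩ := exists_rat_linearMap_near s hs0 hε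
  obtain ⟨D, hD, N, hN⟩ := exists_nat_multiple φ s fun v hv => (hφ v hv).2
  have hsum1 : ∀ B : Finset K, v1 B = ∑ a ∈ B, v1 {a} := by
    intro B
    simp only [v1, Finset.coe_singleton]
    exact (sum_measureReal_preimage_singleton B fun a _ => hP a).symm
  have hsum2 : ∀ j a, v1 {a} = ∑ b, v2 (j, a, b) := by
    intro j a
    simp only [v1, v2, Finset.coe_singleton]
    rw [← measureReal_biUnion_finset]
    · congr 1
      ext x
      simp
    · intro b _ b' _ hbb'
      refine Set.disjoint_left.2 fun x hx hx' => hbb' (hx.2.symm.trans hx'.2)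
    · exact fun b _ => hpair j a b
  have hsymm : ∀ j a b, v2 (inv j, b, a) = v2 (j, a, b) := by
    intro j a b
    simp only [v2, Measure.real]
    rw [← (hT j).measure_preimage (hpair (inv j) b a).nullMeasurableSet]
    congr 2
    ext x
    simp [hTinv, and_comm]
  have hNsum1 : ∀ B, (N (v1 B) : ℚ) = ∑ a ∈ B, (N (v1 {a}) : ℚ) := by
    intro B
    simp only [hN _ (hs1 _), ← Finset.mul_sum]
    rw [hsum1, map_sum]
  have hNsum2 : ∀ j a, N (v1 {a}) = ∑ b, N (v2 (j, a, b)) := by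
    intro j a
    have : (N (v1 {a}) : ℚ) = ∑ b, (N (v2 (j, a, b)) : ℚ) := by
      simp only [hN _ (hs1 _), hN _ (hs2 _), ← Finset.mul_sum]
      rw [hsum2 j, map_sum]
    exact_mod_cast this
  have hpos : ∀ v ∈ s, 0 < N v → v ≠ 0 := by
    rintro v hv h rfl
    have := hN _ hv
    simp only [map_zero, mul_zero, Nat.cast_eq_zero] at this
    omega
  have hcard : ∀ B : Finset K,
      ((fun y : Σ a, Fin (N (v1 {a})) => y.1) ⁻¹' (B : Set K)).ncard = N (v1 B) := by
    intro B
    have h1 : ((fun y : Σ a, Fin (N (v1 {a})) => y.1) ⁻¹' (B : Set K))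
        = ↑(B.sigma fun _ => Finset.univ : Finset (Σ a, Fin (N (v1 {a})))) := by
      ext y
      simp
    rw [h1, Set.ncard_coe_finset, Finset.card_sigma]
    have := hNsum1 B
    simp only [Finset.card_univ, Fintype.card_fin]
    exact_mod_cast this.symm
  have hcardY : Nat.card (Σ a, Fin (N (v1 {a}))) = D := by
    have h1 := hcard Finset.univ
    simp only [Finset.coe_univ, Set.preimage_univ, Set.ncard_univ] at h1
    have h2 : v1 Finset.univ = 1 := by simp [v1]
    have h3 := hN _ (hs1 Finset.univ)
    rw [h2, hφ1, mul_one] at h3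
    rw [h1, h2]
    exact_mod_cast h3
  obtain ⟨t, ht, htpos⟩ := exists_matching (fun a => N (v1 {a})) (fun j a b => N (v2 (j, a, b)))
    inv hinv hNsum2 fun j a b => by rw [hsymm]
  have hD' : (D : ℝ) ≠ 0 := by positivity
  refine ⟨Σ a, Fin (N (v1 {a})), inferInstance, ?_, fun y => y.1, t, ?_, ?_, ?_, ?_⟩
  · refine (Nat.card_pos_iff.1 ?_).1
    rw [hcardY]
    exact hD
  · exact ht
  · intro j y h
    refine hpos _ (hs2 (j, y.1, (t j y).1)) (htpos j y) ?_
    simp only [v2, Measure.real]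
    rw [ENNReal.toReal_eq_zero_iff]
    exact Or.inl h
  · rintro ⟨a, k⟩ h
    refine hpos _ (hs1 {a}) ((Nat.zero_le _).trans_lt k.isLt) ?_
    simp only [v1, Measure.real, Finset.coe_singleton]
    rw [ENNReal.toReal_eq_zero_iff]
    exact Or.inl h
  · intro B
    have h1 := hcard B.toFinset
    have h2 := hφ _ (hs1 B.toFinset)
    have h3 : (N (v1 B.toFinset) : ℝ) = D * (φ (v1 B.toFinset) : ℝ) := by
      exact_mod_cast congrArg (fun q : ℚ => (q : ℝ)) (hN _ (hs1 B.toFinset))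
    rw [Set.coe_toFinset] at h1
    rw [h1, hcardY, h3, mul_div_cancel_left₀ _ hD']
    have h4 : μ.real (P ⁻¹' B) = v1 B.toFinset := by simp [v1]
    rw [h4]
    exact h2.1

end Matching

/-! ### Words acting by paths, and acyclicity -/

section Words

variable {J X Y Z K : Type*}

/-- The action of a word `w` in maps `t j`; the last letter acts first. -/
def wordAct (t : J → Y → Y) (w : List J) (y : Y) : Y := w.foldr t y

@[simp] theorem wordAct_nil (t : J → Y → Y) (y : Y) : wordAct t [] y = y := rfl

@[simp] theorem wordAct_cons (t : J → Y → Y) (j : J) (w : List J) (y : Y) :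
    wordAct t (j :: w) y = t j (wordAct t w y) := rfl

theorem wordAct_append (t : J → Y → Y) (v w : List J) (y : Y) :
    wordAct t (v ++ w) y = wordAct t v (wordAct t w y) := List.foldr_append

theorem wordAct_map {L : Type*} (t : J → Y → Y) (f : L → J) (w : List L) (y : Y) :
    wordAct t (w.map f) y = wordAct (fun l => t (f l)) w y := List.foldr_map

theorem wordAct_inverse (t : J → Y → Y) (inv : J → J) (hinv : ∀ j y, t (inv j) (t j y) = y)
    (w : List J) (y : Y) : wordAct t (w.reverse.map inv) (wordAct t w y) = y := by
  induction w with
  | nil => rfl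
  | cons j w ih =>
    rw [List.reverse_cons, List.map_append, wordAct_append, wordAct_cons]
    simpa [hinv] using ih

theorem wordAct_eq_wordAct_iff {t : J → Y → Y} {inv : J → J} (hinv : ∀ j, inv (inv j) = j)
    (ht : ∀ j y, t (inv j) (t j y) = y) (v w : List J) (y : Y) :
    wordAct t v y = wordAct t w y ↔ wordAct t (w.reverse.map inv ++ v) y = y := by
  rw [wordAct_append]
  constructor
  · intro e
    rw [e, wordAct_inverse t inv ht]
  · intro e
    have h1 := congrArg (wordAct t w) e
    have h2 := wordAct_inverse t inv ht (w.reverse.map inv) (wordAct t v y)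
    have h3 : (List.map inv (List.map inv w.reverse).reverse) = w := by
      simp [List.map_reverse, Function.comp_def, hinv]
    rw [h3] at h2
    rw [← h2, h1]

/-- A word is reduced, relative to the inversion `inv` of letters, if no letter is followed by its
inverse. -/
def IsReducedWord (inv : J → J) (w : List J) : Prop := w.IsChain fun j k => j ≠ inv k

/-- Along the path from `y` that is given by the word `w`, every letter moves the point. -/
def IsMovingPath (t : J → Y → Y) : List J → Y → Prop
  | [], _ => True
  | j :: w, y => t j (wordAct t w y) ≠ wordAct t w y ∧ IsMovingPath t w y

/-- No reduced word of positive length at most `R` gives a closed path from `y` along which every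
letter moves the point. Letters that fix points are the loops of the graph, and they are
disregarded. -/
def IsAcyclicAt (inv : J → J) (t : J → Y → Y) (R : ℕ) (y : Y) : Prop :=
  ∀ w : List J, w.length ≤ R → w ≠ [] → IsReducedWord inv w → IsMovingPath t w y →
    wordAct t w y ≠ y

/-- Maps `t j` in inverse pairs, together with a state `p y` of each point `y` which tells, by the
predicate `F`, which of the maps fix `y`. -/
structure IsStateSystem (inv : J → J) (F : K → J → Prop) (t : J → Y → Y) (p : Y → K) : Prop where
  inv_apply : ∀ j y, t (inv j) (t j y) = y
  apply_eq_iff : ∀ j y, t j y = y ↔ F (p y) j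

/-- Along all words of length at most `R` the same states are seen from the points `x` and `z`. -/
def SameStates (T : J → X → X) (P : X → K) (t : J → Z → Z) (p : Z → K) (R : ℕ) (x : X) (z : Z) :
    Prop :=
  ∀ w : List J, w.length ≤ R → P (wordAct T w x) = p (wordAct t w z)

/-- A word may be replaced by a reduced word whose path is moving, at two points with
the same states along words simultaneously. -/
theorem SameStates.exists_reduced {inv : J → J} {T : J → X → X} {P : X → K} {t : J → Z → Z}
    {p : Z → K} {F : K → J → Prop} {R : ℕ} {x : X} {z : Z} (h : SameStates T P t p R x z)
    (hT : IsStateSystem inv F T P) (ht : IsStateSystem inv F t p) (w : List J) (hw : w.length ≤ R) :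
    ∃ v : List J, v.length ≤ w.length ∧ IsReducedWord inv v ∧ IsMovingPath T v x ∧
      IsMovingPath t v z ∧ wordAct T v x = wordAct T w x ∧ wordAct t v z = wordAct t w z := by
  induction w with
  | nil => exact ⟨[], le_rfl, List.isChain_nil, trivial, trivial, rfl, rfl⟩
  | cons j w ih =>
    rw [List.length_cons] at hw
    obtain ⟨v, hv, hred, hX, hZ, eX, eZ⟩ := ih (by omega)
    have hfix : T j (wordAct T v x) = wordAct T v x ↔ t j (wordAct t v z) = wordAct t v z := by
      rw [hT.apply_eq_iff, ht.apply_eq_iff, h v (by omega)]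
    by_cases hj : T j (wordAct T v x) = wordAct T v x
    · refine ⟨v, hv.trans (by simp), hred, hX, hZ, ?_, ?_⟩
      · rw [wordAct_cons, ← eX, hj]
      · rw [wordAct_cons, ← eZ, hfix.1 hj]
    · by_cases hc : IsReducedWord inv (j :: v)
      · exact ⟨j :: v, by simpa using hv, hc, ⟨hj, hX⟩, ⟨mt hfix.2 hj, hZ⟩,
          by simp [eX], by simp [eZ]⟩
      · cases v with
        | nil => exact absurd (List.isChain_singleton j) hc
        | cons k v =>
          have hjk : j = inv k := by
            by_contra hne
            exact hc (List.isChain_cons_cons.2 ⟨hne, hred⟩)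
          rw [List.length_cons] at hv
          refine ⟨v, by rw [List.length_cons]; omega, ?_, hX.2, hZ.2, ?_, ?_⟩
          · exact List.IsChain.tail hred
          · rw [wordAct_cons, ← eX, wordAct_cons, hjk, hT.inv_apply]
          · rw [wordAct_cons, ← eZ, wordAct_cons, hjk, ht.inv_apply]

/-- At points with the same states along words and with acyclic neighborhoods, the same words give
closed paths. -/
theorem SameStates.wordAct_eq_self_iff {inv : J → J} {T : J → X → X} {P : X → K} {t : J → Z → Z}
    {p : Z → K} {F : K → J → Prop} {R : ℕ} {x : X} {z : Z} (h : SameStates T P t p R x z)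
    (hT : IsStateSystem inv F T P) (ht : IsStateSystem inv F t p)
    (hx : IsAcyclicAt inv T R x) (hz : IsAcyclicAt inv t R z)
    (w : List J) (hw : w.length ≤ R) : wordAct T w x = x ↔ wordAct t w z = z := by
  obtain ⟨v, hv, hred, hX, hZ, eX, eZ⟩ := h.exists_reduced hT ht w hw
  rw [← eX, ← eZ]
  by_cases hnil : v = []
  · simp [hnil]
  · exact iff_of_false (hx v (hv.trans hw) hnil hred hX) (hz v (hv.trans hw) hnil hred hZ)

theorem SameStates.wordAct_eq_iff {inv : J → J} {T : J → X → X} {P : X → K} {t : J → Z → Z}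
    {p : Z → K} {F : K → J → Prop} {R : ℕ} {x : X} {z : Z} (h : SameStates T P t p R x z)
    (hinv : ∀ j, inv (inv j) = j)
    (hT : IsStateSystem inv F T P) (ht : IsStateSystem inv F t p)
    (hx : IsAcyclicAt inv T R x) (hz : IsAcyclicAt inv t R z)
    (v w : List J) (hvw : v.length + w.length ≤ R) :
    wordAct T v x = wordAct T w x ↔ wordAct t v z = wordAct t w z := by
  rw [wordAct_eq_wordAct_iff hinv hT.inv_apply, wordAct_eq_wordAct_iff hinv ht.inv_apply]
  exact h.wordAct_eq_self_iff hT ht hx hz _ (by simp; omega)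

end Words

/-! ### Finite groups in which short reduced words are nontrivial -/

section ReducedBall

variable {J : Type}

/-- The words of length at most `M` without two equal adjacent letters: the ball of radius `M` in
the free product of copies of `ℤ/2`. -/
abbrev ReducedBall (J : Type) (M : ℕ) : Type :=
  {w : List J // w.length ≤ M ∧ w.IsChain (· ≠ ·)}

instance [Finite J] (M : ℕ) : Finite (ReducedBall J M) :=
  ((List.finite_length_le J M).subset fun _ h => h.1).to_subtype

open Classical in
/-- Left multiplication by the letter `j` in the ball of the free product, where the words that
would leave the ball stay fixed. -/
noncomputable def ballStep (M : ℕ) (j : J) (w : ReducedBall J M) : ReducedBall J M :=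
  if h : w.1.head? = some j then ⟨w.1.tail, by
      have := w.2.1
      rw [List.length_tail]
      omega, w.2.2.tail⟩
  else if h' : w.1.length < M then ⟨j :: w.1, h', by
      rw [List.isChain_cons]
      refine ⟨fun k hk e => h ?_, w.2.2⟩
      rw [e]
      exact hk⟩
  else w

theorem ballStep_ballStep (M : ℕ) (j : J) (w : ReducedBall J M) :
    ballStep M j (ballStep M j w) = w := by
  obtain ⟨w, hw, hc⟩ := w
  by_cases h : w.head? = some j
  · cases w with
    | nil => simp at h
    | cons k w =>
      obtain rfl : k = j := by simpa using h
      have h1 : ballStep M k ⟨k :: w, hw, hc⟩ = ⟨w, by simp at hw; omega, hc.tail⟩ := by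
        simp [ballStep]
      have h2 : ¬ w.head? = some k := fun h => (List.isChain_cons.1 hc).1 k h rfl
      have h3 : w.length < M := by simp at hw; omega
      rw [h1]
      simp [ballStep, h2, h3]
  · by_cases h' : w.length < M
    · simp [ballStep, h, h']
    · have h1 : ballStep M j ⟨w, hw, hc⟩ = ⟨w, hw, hc⟩ := by simp [ballStep, h, h']
      rw [h1, h1]

/-- The involution of the ball given by the letter `j`. -/
noncomputable def ballPerm (M : ℕ) (j : J) : Equiv.Perm (ReducedBall J M) :=
  Function.Involutive.toPerm (ballStep M j) (ballStep_ballStep M j)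

theorem ballPerm_mul_self (M : ℕ) (j : J) : ballPerm M j * ballPerm M j = 1 :=
  Equiv.ext fun w => ballStep_ballStep M j w

theorem ballPerm_prod_ne_one (M : ℕ) (w : List J) (hw : w.length ≤ M) (hc : w.IsChain (· ≠ ·))
    (hne : w ≠ []) : (w.map (ballPerm M)).prod ≠ 1 := by
  have key : ∀ (w : List J) (hw : w.length ≤ M) (hc : w.IsChain (· ≠ ·)),
      (w.map (ballPerm M)).prod ⟨[], by simp, List.isChain_nil⟩ = ⟨w, hw, hc⟩ := by
    intro w
    induction w with
    | nil => intro _ _; rfl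
    | cons j w ih =>
      intro hw hc
      have h2 : ¬ w.head? = some j := fun h => (List.isChain_cons.1 hc).1 j h rfl
      have h3 : w.length < M := hw
      rw [List.map_cons, List.prod_cons, Equiv.Perm.mul_apply, ih h3.le hc.tail]
      change ballStep M j _ = _
      simp [ballStep, h2, h3]
  intro h
  have h1 := key w hw hc
  rw [h] at h1
  exact hne (congrArg Subtype.val h1).symm

/-- There is a finite group with elements `a j`, `a (inv j) = (a j)⁻¹`, in which all nonempty reduced
words of length at most `R` are different from `1`. For a letter that is not its own inverse, `a j`
is the product of two of the involutions of the ball. -/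
theorem exists_finite_group_reduced_ne_one [Finite J] (inv : J → J) (hinv : ∀ j, inv (inv j) = j)
    (R : ℕ) : ∃ (Q : Type) (_ : Group Q) (_ : Finite Q) (a : J → Q),
      (∀ j, a (inv j) * a j = 1) ∧
      ∀ w : List J, w.length ≤ R → w ≠ [] → IsReducedWord inv w → (w.map a).prod ≠ 1 := by
  classical
  let blk : J → List J := fun j => if inv j = j then [j] else [j, inv j]
  have hlen : ∀ j, (blk j).length ≤ 2 := by
    intro j
    simp only [blk]
    split_ifs <;> simp
  let a : J → Equiv.Perm (ReducedBall J (2 * R)) := fun j => ((blk j).map (ballPerm _)).prod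
  refine ⟨_, inferInstance, inferInstance, a, fun j => ?_, fun w hw hne hred => ?_⟩
  · by_cases h : inv j = j
    · simp [a, blk, h, ballPerm_mul_self]
    · have h' : ¬ j = inv j := fun e => h e.symm
      have h1 : a j = ballPerm _ j * ballPerm _ (inv j) := by simp [a, blk, h]
      have h2 : a (inv j) = ballPerm _ (inv j) * ballPerm _ j := by simp [a, blk, hinv, h']
      rw [h1, h2, mul_assoc, ← mul_assoc (ballPerm _ j), ballPerm_mul_self, one_mul,
        ballPerm_mul_self]
  · have hprod : (w.map a).prod = ((w.flatMap blk).map (ballPerm (2 * R))).prod := by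
      clear hw hne hred
      induction w with
      | nil => rfl
      | cons j w ih => simp [ih, a]
    have hl : (w.flatMap blk).length ≤ 2 * w.length := by
      clear hw hne hred hprod
      induction w with
      | nil => simp
      | cons j w ih =>
        have := hlen j
        simp only [List.flatMap_cons, List.length_append, List.length_cons]
        omega
    -- a block begins with its letter and ends with the inverse of its letter
    have hhead : ∀ w : List J, (w.flatMap blk).head? = w.head? := by
      intro w
      cases w with
      | nil => rfl
      | cons j w =>
        simp only [List.flatMap_cons, blk]
        split_ifs <;> simp
    have hchain : ∀ w : List J, IsReducedWord inv w → (w.flatMap blk).IsChain (· ≠ ·) := by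
      intro w
      induction w with
      | nil => intro _; exact List.isChain_nil
      | cons j w ih =>
        intro h
        have hih := ih h.tail
        have hcons : ∀ k ∈ (w.flatMap blk).head?, inv j ≠ k := by
          intro k hk e
          rw [hhead] at hk
          exact (List.isChain_cons.1 h).1 k hk (by rw [← e, hinv])
        have h2 : (inv j :: w.flatMap blk).IsChain (· ≠ ·) := List.isChain_cons.2 ⟨hcons, hih⟩
        by_cases hj : inv j = j
        · rw [hj] at h2
          simpa [blk, hj] using h2
        · have : (j :: inv j :: w.flatMap blk).IsChain (· ≠ ·) :=
            List.isChain_cons_cons.2 ⟨fun e => hj e.symm, h2⟩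
          simpa [blk, hj] using this
    rw [hprod]
    refine ballPerm_prod_ne_one _ _ (by omega) (hchain w hred) fun h => ?_
    have := hhead w
    rw [h] at this
    cases w with
    | nil => exact hne rfl
    | cons j w => simp at this

end ReducedBall

/-! ### Finite models without short cycles -/

section Model

variable {X : Type*} [MeasurableSpace X] {K J : Type}

/-- The states that are seen from `x` along the words of length at most `R`. -/
def wordStates (T : J → X → X) (P : X → K) (R : ℕ) (x : X) :
    {w : List J // w.length ≤ R} → K := fun w => P (wordAct T w.1 x)

theorem measurable_wordAct {T : J → X → X} (hT : ∀ j, Measurable (T j)) (w : List J) :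
    Measurable (wordAct T w) := by
  induction w with
  | nil => exact measurable_id
  | cons j w ih => exact (hT j).comp ih

theorem measurableSet_wordStates [Finite J] {T : J → X → X} (hT : ∀ j, Measurable (T j))
    {P : X → K} (hP : ∀ a, MeasurableSet (P ⁻¹' {a})) (R : ℕ)
    (a : {w : List J // w.length ≤ R} → K) :
    MeasurableSet (wordStates T P R ⁻¹' {a}) := by
  have : Finite {w : List J // w.length ≤ R} := (List.finite_length_le J R).to_subtype
  have h : wordStates T P R ⁻¹' {a} = ⋂ w, wordAct T w.1 ⁻¹' (P ⁻¹' {a w}) := by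
    ext x
    simp [wordStates, funext_iff]
  rw [h]
  exact MeasurableSet.iInter fun w => measurable_wordAct hT w.1 (hP _)

/-- Finite models of a system of measure-preserving maps: every point of the model sees the same
states as a point of `X` from a given conull set, the model has no short cycles, its transitions
occur in `X`, and the sets that are given by the states along words of length `R` have nearly the
right sizes. The short cycles of the model of `exists_finite_matching` are destroyed in the product
with a finite group in which short reduced words are nontrivial: a letter that moves the point also
multiplies the second coordinate by a group element. -/
theorem exists_finite_model [Finite K] [Finite J] (μ : Measure X) [IsProbabilityMeasure μ]
    {P : X → K} (hP : ∀ a, MeasurableSet (P ⁻¹' {a})) {inv : J → J} (hinv : ∀ j, inv (inv j) = j)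
    {F : K → J → Prop} {T : J → X → X} (hT : ∀ j, MeasurePreserving (T j) μ μ)
    (hTF : IsStateSystem inv F T P) {good : X → Prop} (hgood : ∀ᵐ x ∂μ, good x)
    {R : ℕ} (hR : 1 ≤ R) {ε : ℝ} (hε : 0 < ε) :
    ∃ (Z : Type) (_ : Finite Z) (_ : Nonempty Z) (t : J → Z → Z) (p : Z → K) (c : Z → X),
      IsStateSystem inv F t p ∧ (∀ z, IsAcyclicAt inv t R z) ∧
      (∀ z, good (c z)) ∧ (∀ z, SameStates T P t p R (c z) z) ∧
      ∀ B : Set ({w : List J // w.length ≤ R} → K),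
        |(((fun z => wordStates T P R (c z)) ⁻¹' B).ncard : ℝ) / (Nat.card Z : ℝ) -
          μ.real (wordStates T P R ⁻¹' B)| < ε := by
  classical
  have : Finite {w : List J // w.length ≤ R} := (List.finite_length_le J R).to_subtype
  have hnil : ([] : List J).length ≤ R := Nat.zero_le _
  obtain ⟨Y, _, _, p', t, htinv, hpair, hpos, hdist⟩ :=
    exists_finite_matching μ (wordStates T P R)
      (measurableSet_wordStates (fun j => (hT j).measurable) hP R) inv hinv T hT hTF.inv_apply hε
  obtain ⟨Q, _, _, a, hainv, ha⟩ := exists_finite_group_reduced_ne_one inv hinv R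
  let p : Y × Q → K := fun z => p' z.1 ⟨[], hnil⟩
  let t' : J → Y × Q → Y × Q := fun j z => if F (p z) j then z else (t j z.1, a j * z.2)
  have hc : ∀ y, ∃ x, wordStates T P R x = p' y ∧ good x := by
    intro y
    by_contra! h
    exact hpos y (measure_mono_null (fun x hx => h x hx) (ae_iff.1 hgood))
  choose c hcp hcg using hc
  have hpair' : ∀ j y, ∃ x, wordStates T P R x = p' y ∧ wordStates T P R (T j x) = p' (t j y) := by
    intro j y
    obtain ⟨x, hx⟩ := nonempty_of_measure_ne_zero (hpair j y)
    exact ⟨x, hx⟩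
  -- the transitions of the product still occur in `X`
  have hstep : ∀ j (z : Y × Q), ∃ x, wordStates T P R x = p' z.1 ∧
      wordStates T P R (T j x) = p' (t' j z).1 := by
    intro j z
    by_cases h : F (p z) j
    · refine ⟨c z.1, hcp _, ?_⟩
      have h1 : T j (c z.1) = c z.1 := by
        rw [hTF.apply_eq_iff]
        have h2 := congrFun (hcp z.1) ⟨[], hnil⟩
        simp only [wordStates, wordAct_nil] at h2
        rw [h2]
        exact h
      simp only [t', if_pos h, h1, hcp]
    · simpa only [t', if_neg h] using hpair' j z.1
  have hsys : IsStateSystem inv F t' p := by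
    refine ⟨fun j z => ?_, fun j z => ?_⟩
    · obtain ⟨x, hx, hx'⟩ := hstep j z
      have h1 : P x = p z := congrFun hx ⟨[], hnil⟩
      have h2 : P (T j x) = p (t' j z) := congrFun hx' ⟨[], hnil⟩
      have h3 : T (inv j) (T j x) = x := hTF.inv_apply j x
      by_cases h : F (p z) j
      · have h4 : T j x = x := by rwa [hTF.apply_eq_iff, h1]
        have h5 : T (inv j) x = x := by rwa [h4] at h3
        rw [hTF.apply_eq_iff, h1] at h5
        simp only [t', if_pos h, if_pos h5]
      · have h4 : ¬ T j x = x := by rwa [hTF.apply_eq_iff, h1]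
        have h5 : ¬ F (p (t' j z)) (inv j) := by
          rw [← h2, ← hTF.apply_eq_iff, h3]
          exact fun e => h4 e.symm
        have h6 : t' (inv j) (t' j z) = (t (inv j) (t' j z).1, a (inv j) * (t' j z).2) :=
          if_neg h5
        rw [h6]
        simp only [t', if_neg h]
        rw [htinv, ← mul_assoc, hainv, one_mul]
    · by_cases h : F (p z) j
      · simp only [t', if_pos h, h]
      · simp only [t', if_neg h, h, iff_false]
        intro e
        have h1 : a j = 1 := by simpa using congrArg Prod.snd e
        exact ha [j] hR (by simp) (List.isChain_singleton j) (by simpa using h1)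
  have hacyc : ∀ z, IsAcyclicAt inv t' R z := by
    intro z w hw hne hred hmov e
    have key : ∀ w : List J, IsMovingPath t' w z →
        (wordAct t' w z).2 = (w.map a).prod * z.2 := by
      intro w
      induction w with
      | nil => intro _; simp
      | cons j w ih =>
        rintro ⟨h1, h2⟩
        have h3 : ¬ F (p (wordAct t' w z)) j := fun h => h1 ((hsys.apply_eq_iff _ _).2 h)
        have h4 : t' j (wordAct t' w z) = (t j (wordAct t' w z).1, a j * (wordAct t' w z).2) :=
          if_neg h3
        rw [wordAct_cons, h4]
        simp only [ih h2, List.map_cons, List.prod_cons, mul_assoc]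
    have h1 := key w hmov
    rw [e] at h1
    exact ha w hw hne hred (by simpa using h1)
  have hsame : ∀ z : Y × Q, SameStates T P t' p R (c z.1) z := by
    intro z w hw
    have key : ∀ (w u : List J) (h : u.length + w.length ≤ R),
        p' (wordAct t' w z).1 ⟨u, by omega⟩ = P (wordAct T (u ++ w) (c z.1)) := by
      intro w
      induction w with
      | nil =>
        intro u hu
        simp only [wordAct_nil, List.append_nil, ← hcp z.1]
        rfl
      | cons j w ih =>
        intro u hu
        rw [List.length_cons] at hu
        obtain ⟨x, hx, hx'⟩ := hstep j (wordAct t' w z)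
        have h1 := ih (u ++ [j]) (by simp; omega)
        rw [← hx] at h1
        rw [wordAct_cons, ← hx']
        simpa [wordStates, wordAct_append] using h1
    exact (key w [] (by simpa using hw)).symm
  refine ⟨Y × Q, inferInstance, inferInstance, t', p, fun z => c z.1, hsys, hacyc,
    fun z => hcg _, hsame, fun B => ?_⟩
  have h1 : (fun z : Y × Q => wordStates T P R (c z.1)) ⁻¹' B = (p' ⁻¹' B) ×ˢ Set.univ := by
    ext z
    simp [hcp]
  have h2 : (Nat.card Q : ℝ) ≠ 0 := by exact_mod_cast Nat.card_pos.ne'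
  rw [h1, Set.ncard_prod, Set.ncard_univ, Nat.card_prod]
  push_cast
  rw [mul_div_mul_right _ _ h2]
  exact hdist B

end Model

/-! ### Isomorphism of neighborhoods in terms of words -/

section Neighborhoods

/-- The action of the letters `(i, true)`, the `i`-th permutation, and `(i, false)`, its inverse. -/
def letterAct {n : ℕ} {Y : Type*} (s : Fin n → Equiv.Perm Y) (l : Fin n × Bool) (y : Y) : Y :=
  if l.2 then s l.1 y else (s l.1).symm y

theorem wordAct_letterAct {G : Type*} [Group G] (γ : ℕ → G) {Y : Type*} (θ : G →* Equiv.Perm Y)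
    {r : ℕ} (l : List (Fin r × Bool)) (y : Y) :
    wordAct (letterAct fun i : Fin r => θ (γ i)) l y =
      θ (l.map fun q => if q.2 then γ q.1 else (γ q.1)⁻¹).prod y := by
  induction l with
  | nil => simp
  | cons q l ih =>
    rw [wordAct_cons, ih, List.map_cons, List.prod_cons, map_mul, Equiv.Perm.mul_apply]
    unfold letterAct
    split_ifs
    · rfl
    · rw [map_inv]
      rfl

theorem exists_mem_wordBall_iff {G : Type*} [Group G] (γ : ℕ → G) {Y : Type*}
    (θ : G →* Equiv.Perm Y) (r : ℕ) (x y : Y) :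
    (∃ w ∈ wordBall γ r, θ w x = y) ↔
      ∃ l : List (Fin r × Bool), l.length ≤ r ∧
        wordAct (letterAct fun i : Fin r => θ (γ i)) l x = y := by
  simp only [wordAct_letterAct]
  constructor
  · rintro ⟨_, ⟨l, hl, hs, rfl⟩, rfl⟩
    suffices h : ∃ l' : List (Fin r × Bool), l'.length = l.length ∧
        (l'.map fun q => if q.2 then γ q.1 else (γ q.1)⁻¹) = l by
      obtain ⟨l', h1, h2⟩ := h
      exact ⟨l', h1.trans_le hl, by rw [h2]⟩
    clear hl
    induction l with
    | nil => exact ⟨[], rfl, rfl⟩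
    | cons g l ih =>
      obtain ⟨l', h1, h2⟩ := ih fun s h => hs s (List.mem_cons_of_mem _ h)
      obtain ⟨i, hi, h | h⟩ := hs g List.mem_cons_self
      · exact ⟨(⟨i, hi⟩, true) :: l', by simp [h1], by simp [h2, h]⟩
      · exact ⟨(⟨i, hi⟩, false) :: l', by simp [h1], by simp [h2, h]⟩
  · rintro ⟨l, hl, rfl⟩
    refine ⟨_, ⟨_, (List.length_map _).trans_le hl, ?_, rfl⟩, rfl⟩
    intro s hs
    obtain ⟨q, _, rfl⟩ := List.mem_map.1 hs
    refine ⟨q.1, q.1.2, ?_⟩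
    by_cases h : q.2 <;> simp [h]

theorem LabeledNbhd.Iso.symm {r : ℕ} {α β : LabeledNbhd r} (h : α.Iso β) : β.Iso α := by
  obtain ⟨f, h1, h2, h3⟩ := h
  refine ⟨f.symm, by rw [← h1, f.symm_apply_apply], fun i v w => ?_, fun v => ?_⟩
  · rw [h2, f.apply_symm_apply, f.apply_symm_apply]
  · rw [h3, f.apply_symm_apply]

theorem LabeledNbhd.Iso.trans {r : ℕ} {α β δ : LabeledNbhd r} (h : α.Iso β) (h' : β.Iso δ) :
    α.Iso δ := by
  obtain ⟨f, h1, h2, h3⟩ := h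
  obtain ⟨g, k1, k2, k3⟩ := h'
  refine ⟨f.trans g, by simp [h1, k1], fun i v w => ?_, fun v => ?_⟩
  · rw [h2, k2]
    rfl
  · rw [h3, k3]
    rfl

/-- The isomorphism type of a neighborhood depends only on which words lead to the same point and
on the labels at the ends of the words. The words on one side have length `r + 1`, because they
consist of a word of length `r` and an edge. -/
theorem nbhd_iso {G G' : Type*} [Group G] [Group G'] {γ : ℕ → G} {γ' : ℕ → G'} {Y Y' : Type}
    {θ : G →* Equiv.Perm Y} {θ' : G' →* Equiv.Perm Y'} {lab : Y → Cantor} {lab' : Y' → Cantor}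
    {r : ℕ} {x : Y} {x' : Y'}
    (heq : ∀ v w : List (Fin r × Bool), v.length ≤ r + 1 → w.length ≤ r →
      (wordAct (letterAct fun i : Fin r => θ (γ i)) v x =
          wordAct (letterAct fun i : Fin r => θ (γ i)) w x ↔
        wordAct (letterAct fun i : Fin r => θ' (γ' i)) v x' =
          wordAct (letterAct fun i : Fin r => θ' (γ' i)) w x'))
    (hlab : ∀ w : List (Fin r × Bool), w.length ≤ r → ∀ k : Fin r,
      lab (wordAct (letterAct fun i : Fin r => θ (γ i)) w x) k =
        lab' (wordAct (letterAct fun i : Fin r => θ' (γ' i)) w x') k) :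
    (nbhd γ θ lab r x).Iso (nbhd γ' θ' lab' r x') := by
  have hV := fun v : (nbhd γ θ lab r x).V => (exists_mem_wordBall_iff γ θ r x v.1).1 v.2
  have hV' := fun v : (nbhd γ' θ' lab' r x').V =>
    (exists_mem_wordBall_iff γ' θ' r x' v.1).1 v.2
  choose c hc hcv using hV
  choose c' hc' hcv' using hV'
  let f : (nbhd γ θ lab r x).V → (nbhd γ' θ' lab' r x').V := fun v =>
    ⟨_, (exists_mem_wordBall_iff γ' θ' r x' _).2 ⟨c v, hc v, rfl⟩⟩
  let f' : (nbhd γ' θ' lab' r x').V → (nbhd γ θ lab r x).V := fun v =>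
    ⟨_, (exists_mem_wordBall_iff γ θ r x _).2 ⟨c' v, hc' v, rfl⟩⟩
  have hf : ∀ (v : (nbhd γ θ lab r x).V) (w : List (Fin r × Bool)), w.length ≤ r + 1 →
      (wordAct (letterAct fun i : Fin r => θ (γ i)) w x = v.1 ↔
        wordAct (letterAct fun i : Fin r => θ' (γ' i)) w x' = (f v).1) := by
    intro v w hw
    conv_lhs => rw [← hcv v]
    exact heq w (c v) hw (hc v)
  refine ⟨⟨f, f', fun v => Subtype.ext ?_, fun v => Subtype.ext ?_⟩, Subtype.ext ?_, ?_, ?_⟩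
  · exact (hf v _ ((hc' _).trans (Nat.le_succ r))).2 (hcv' (f v))
  · rw [← hcv' v]
    exact ((hf (f' v) _ ((hc' v).trans (Nat.le_succ r))).1 rfl).symm
  · exact ((hf _ [] (Nat.zero_le _)).1 rfl).symm
  · intro i v w
    have h := hf w ((i, true) :: c v) (by simpa using hc v)
    rw [wordAct_cons, wordAct_cons, hcv v] at h
    exact h
  · intro v
    funext k
    have h := hlab (c v) (hc v) k
    rw [hcv v] at h
    exact h

end Neighborhoods

/-! ### Neighborhoods are determined by the states along words -/

section Coding

variable {K J : Type} {G : Type*} [Group G]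

/-- The action `θ` of `G` on a labeled set is coded by a system of maps `t` with states `p`: the
state of a point `y` determines which map sends `y` to its image under each of the first `n`
generators and their inverses, and the first `n` digits of the label of `y`. -/
structure IsCoded (γ : ℕ → G) (n : ℕ) (inv : J → J) (F : K → J → Prop)
    (m : K → Fin n × Bool → J) (ℓ : K → Fin n → Bool) {Y : Type} (θ : G →* Equiv.Perm Y)
    (lab : Y → Cantor) (t : J → Y → Y) (p : Y → K) : Prop extends IsStateSystem inv F t p where
  letterAct_eq : ∀ l y, letterAct (fun i : Fin n => θ (γ i)) l y = t (m (p y) l) y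
  label_eq : ∀ y (k : Fin n), lab y k = ℓ (p y) k

theorem SameStates.exists_word {X Z : Type*} {n : ℕ} {T : J → X → X} {P : X → K} {t : J → Z → Z}
    {p : Z → K} {m : K → Fin n × Bool → J} {R : ℕ} {x : X} {z : Z}
    {a : Fin n × Bool → X → X} {b : Fin n × Bool → Z → Z}
    (h : SameStates T P t p R x z)
    (ha : ∀ l y, a l y = T (m (P y) l) y) (hb : ∀ l y, b l y = t (m (p y) l) y)
    (w : List (Fin n × Bool)) (hw : w.length ≤ R) :
    ∃ v : List J, v.length = w.length ∧ wordAct a w x = wordAct T v x ∧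
      wordAct b w z = wordAct t v z := by
  induction w with
  | nil => exact ⟨[], rfl, rfl, rfl⟩
  | cons l w ih =>
    rw [List.length_cons] at hw
    obtain ⟨v, hv, h1, h2⟩ := ih (by omega)
    refine ⟨m (P (wordAct T v x)) l :: v, by simp [hv], ?_, ?_⟩
    · rw [wordAct_cons, h1, ha, wordAct_cons]
    · rw [wordAct_cons, h2, hb, wordAct_cons, h v (by omega)]

theorem SameStates.word_eq_iff {X Z : Type*} {n : ℕ} {T : J → X → X} {P : X → K} {t : J → Z → Z}
    {p : Z → K} {m : K → Fin n × Bool → J} {R : ℕ} {x : X} {z : Z}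
    {a : Fin n × Bool → X → X} {b : Fin n × Bool → Z → Z}
    (h : SameStates T P t p R x z)
    (ha : ∀ l y, a l y = T (m (P y) l) y) (hb : ∀ l y, b l y = t (m (p y) l) y)
    {inv : J → J} {F : K → J → Prop} (hinv : ∀ j, inv (inv j) = j)
    (hT : IsStateSystem inv F T P) (ht : IsStateSystem inv F t p)
    (hx : IsAcyclicAt inv T R x) (hz : IsAcyclicAt inv t R z)
    (v w : List (Fin n × Bool)) (hvw : v.length + w.length ≤ R) :
    wordAct a v x = wordAct a w x ↔ wordAct b v z = wordAct b w z := by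
  obtain ⟨v', hv', h1, h2⟩ := h.exists_word ha hb v (by omega)
  obtain ⟨w', hw', h3, h4⟩ := h.exists_word ha hb w (by omega)
  rw [h1, h2, h3, h4]
  exact h.wordAct_eq_iff hinv hT ht hx hz v' w' (by omega)

theorem SameStates.nbhd_iso {γ : ℕ → G} {n : ℕ} {inv : J → J} (hinv : ∀ j, inv (inv j) = j)
    {F : K → J → Prop} {m : K → Fin n × Bool → J} {ℓ : K → Fin n → Bool} {X Z : Type}
    {θ : G →* Equiv.Perm X} {lab : X → Cantor} {T : J → X → X} {P : X → K}
    {θ' : G →* Equiv.Perm Z} {lab' : Z → Cantor} {t : J → Z → Z} {p : Z → K} {R : ℕ}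
    {x : X} {z : Z}
    (h : SameStates T P t p R x z) (hX : IsCoded γ n inv F m ℓ θ lab T P)
    (hZ : IsCoded γ n inv F m ℓ θ' lab' t p)
    (hx : IsAcyclicAt inv T R x) (hz : IsAcyclicAt inv t R z) {r : ℕ} (hr : r ≤ n)
    (hR : 2 * n + 1 ≤ R) : (nbhd γ θ lab r x).Iso (nbhd γ θ' lab' r z) := by
  let g : Fin r × Bool → Fin n × Bool := Prod.map (Fin.castLE hr) id
  have key : ∀ {Y : Type} (η : G →* Equiv.Perm Y) (w : List (Fin r × Bool)) (y : Y),
      wordAct (letterAct fun i : Fin r => η (γ i)) w y =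
        wordAct (letterAct fun i : Fin n => η (γ i)) (w.map g) y := by
    intro Y η w y
    rw [wordAct_map]
    rfl
  refine _root_.nbhd_iso (fun v w hv hw => ?_) fun w hw k => ?_
  · simp only [key]
    refine h.word_eq_iff hX.letterAct_eq hZ.letterAct_eq hinv hX.toIsStateSystem
      hZ.toIsStateSystem hx hz _ _ ?_
    simp only [List.length_map]
    omega
  · simp only [key]
    obtain ⟨v, hv, h1, h2⟩ := h.exists_word hX.letterAct_eq hZ.letterAct_eq (w.map g)
      (by simp only [List.length_map]; omega)
    rw [List.length_map] at hv
    have h3 := hX.label_eq (wordAct T v x) (Fin.castLE hr k)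
    have h4 := hZ.label_eq (wordAct t v z) (Fin.castLE hr k)
    rw [h v (by omega)] at h3
    rw [h1, h2]
    exact h3.trans h4.symm

/-- An action that is coded by an acyclic system of measure-preserving maps has finite
approximations, if the permutations of the finite models that take the place of the first `n`
generators define actions of the group. It is enough that they do so when all relations of length
at most `2` which hold for the action `θ` also hold for these permutations. -/
theorem exists_finite_approximation [Finite K] [Finite J] (μ : Measure Cantor)
    [IsProbabilityMeasure μ] {γ : ℕ → G} {θ : G →* Equiv.Perm Cantor} {n : ℕ} {P : Cantor → K}
    (hP : ∀ a, MeasurableSet (P ⁻¹' {a})) {inv : J → J} (hinv : ∀ j, inv (inv j) = j)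
    {F : K → J → Prop} {T : J → Cantor → Cantor} (hT : ∀ j, MeasurePreserving (T j) μ μ)
    (hacyc : ∀ᵐ x ∂μ, ∀ R, IsAcyclicAt inv T R x)
    {m : K → Fin n × Bool → J} {ℓ : K → Fin n → Bool}
    (hcode : IsCoded γ n inv F m ℓ θ id T P)
    (hm : ∀ x i b, m (P (T (m (P x) (i, b)) x)) (i, !b) = inv (m (P x) (i, b)))
    (hlift : ∀ (Z : Type) (s : Fin n → Equiv.Perm Z),
      (∀ w : List (Fin n × Bool), w.length ≤ 2 →
        (∀ x, wordAct (letterAct fun i : Fin n => θ (γ i)) w x = x) →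
          ∀ z, wordAct (letterAct s) w z = z) →
      ∃ θ' : G →* Equiv.Perm Z, ∀ i : Fin n, θ' (γ i) = s i)
    {ε : ℝ} (hε : 0 < ε) :
    ∃ A : FiniteLabeledAction G, ∀ r ≤ n, ∀ α : LabeledNbhd r,
      |((typeSet γ A.action A.label α).ncard : ℝ) / (Nat.card A.Y : ℝ) -
        μ.real (typeSet γ θ id α)| < ε := by
  obtain ⟨R, hR, hR2⟩ : ∃ R, 2 * n + 1 ≤ R ∧ 2 ≤ R := ⟨2 * n + 2, by omega, by omega⟩
  obtain ⟨Z, _, _, t, p, c, hsys, hZac, hgood, hsame, hdist⟩ :=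
    exists_finite_model μ hP hinv hT hcode.toIsStateSystem hacyc (by omega : 1 ≤ R) hε
  have hmz : ∀ z i b, t (m (p (t (m (p z) (i, b)) z)) (i, !b)) (t (m (p z) (i, b)) z) = z := by
    intro z i b
    have h1 : P (c z) = p z := hsame z [] (Nat.zero_le _)
    have h2 : P (T (m (p z) (i, b)) (c z)) = p (t (m (p z) (i, b)) z) :=
      hsame z [m (p z) (i, b)] (by simp; omega)
    have h3 := hm (c z) i b
    rw [h1, h2] at h3
    rw [h3, hsys.inv_apply]
  let s : Fin n → Equiv.Perm Z := fun i =>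
    ⟨fun z => t (m (p z) (i, true)) z, fun z => t (m (p z) (i, false)) z,
      fun z => hmz z i true, fun z => hmz z i false⟩
  have hs : ∀ l z, letterAct s l z = t (m (p z) l) z := by
    rintro ⟨i, _ | _⟩ z <;> rfl
  obtain ⟨θ', hθ'⟩ := hlift Z s fun w hw hx z =>
    ((hsame z).word_eq_iff hcode.letterAct_eq hs hinv hcode.toIsStateSystem hsys (hgood z R)
      (hZac z) w [] (hw.trans hR2)).1 (hx (c z))
  have hcodeZ : IsCoded γ n inv F m ℓ θ' c t p := by
    refine ⟨hsys, fun l z => ?_, fun z k => ?_⟩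
    · simp only [hθ']
      exact hs l z
    · have h1 : P (c z) = p z := hsame z [] (Nat.zero_le _)
      rw [← h1]
      exact hcode.label_eq (c z) k
  refine ⟨⟨Z, θ', c⟩, fun r hr α => ?_⟩
  let B : Set ({w : List J // w.length ≤ R} → K) :=
    {a | ∃ x, (∀ R, IsAcyclicAt inv T R x) ∧ wordStates T P R x = a ∧ x ∈ typeSet γ θ id α}
  have hB : ∀ x, (∀ R, IsAcyclicAt inv T R x) →
      (wordStates T P R x ∈ B ↔ x ∈ typeSet γ θ id α) := by
    intro x hx
    refine ⟨?_, fun h => ⟨x, hx, rfl, h⟩⟩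
    rintro ⟨y, hy, hyx, h⟩
    have hxy : SameStates T P T P R x y := fun w hw => (congrFun hyx ⟨w, hw⟩).symm
    exact (hxy.nbhd_iso hinv hcode hcode (hx R) (hy R) hr hR).trans h
  have hZB : typeSet γ θ' c α = (fun z => wordStates T P R (c z)) ⁻¹' B := by
    ext z
    rw [Set.mem_preimage, hB _ (hgood z)]
    have h := (hsame z).nbhd_iso hinv hcode hcodeZ (hgood z R) (hZac z) hr hR
    exact ⟨fun h' => h.trans h', fun h' => h.symm.trans h'⟩
  have hXB : μ.real (typeSet γ θ id α) = μ.real (wordStates T P R ⁻¹' B) := by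
    refine measureReal_congr ?_
    filter_upwards [hacyc] with x hx
    exact propext (hB x hx).symm
  rw [hXB]
  have h := hdist B
  rw [← hZB] at h
  exact h

theorem isSoficAction_of_approximations {μ : Measure Cantor} {γ : ℕ → G}
    {θ : G →* Equiv.Perm Cantor}
    (h : ∀ (n : ℕ) (ε : ℝ), 0 < ε → ∃ A : FiniteLabeledAction G, ∀ r ≤ n, ∀ α : LabeledNbhd r,
      |((typeSet γ A.action A.label α).ncard : ℝ) / (Nat.card A.Y : ℝ) -
        μ.real (typeSet γ θ id α)| < ε) : IsSoficAction μ γ θ := by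
  choose A hA using fun n : ℕ => h n (1 / ((n : ℝ) + 1)) (by positivity)
  refine ⟨A, fun r _ α => ?_⟩
  rw [tendsto_iff_dist_tendsto_zero]
  refine squeeze_zero' (Eventually.of_forall fun n => dist_nonneg) ?_
    tendsto_one_div_add_atTop_nhds_zero_nat
  filter_upwards [eventually_ge_atTop r] with n hn
  exact (hA n r hn α).le

/-- Soficity passes to the action of a group that acts through a homomorphism matching the
generators. -/
theorem IsSoficAction.comp {G' : Type*} [Group G'] {μ : Measure Cantor} {γ : ℕ → G}
    {θ : G →* Equiv.Perm Cantor} (h : IsSoficAction μ γ θ) (ψ : G' →* G) (γ' : ℕ → G')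
    (hψ : ∀ i, ψ (γ' i) = γ i) : IsSoficAction μ γ' (θ.comp ψ) := by
  obtain ⟨A, hA⟩ := h
  have key : ∀ {Y : Type} (η : G →* Equiv.Perm Y) (lab : Y → Cantor) {r : ℕ} (α : LabeledNbhd r),
      typeSet γ' (η.comp ψ) lab α = typeSet γ η lab α := by
    intro Y η lab r α
    have hiso : ∀ x, (nbhd γ' (η.comp ψ) lab r x).Iso (nbhd γ η lab r x) := fun x =>
      nbhd_iso (fun v w _ _ => by simp only [MonoidHom.comp_apply, hψ])
        fun w _ k => by simp only [MonoidHom.comp_apply, hψ]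
    ext x
    exact ⟨fun h => (hiso x).symm.trans h, fun h => (hiso x).trans h⟩
  refine ⟨fun n => { (A n) with action := (A n).action.comp ψ }, fun r hr α => ?_⟩
  simp only [key]
  exact hA r hr α

end Coding

/-! ### Measurability in the Cantor space -/

instance : IsProbabilityMeasure coinMeasure := by
  unfold coinMeasure
  infer_instance

theorem measurableSet_eq_cantor {f g : Cantor → Cantor} (hf : Measurable f) (hg : Measurable g) :
    MeasurableSet {x | f x = g x} := by
  have h : {x | f x = g x} = ⋂ i, {x | f x i = g x i} := by
    ext x
    simp [funext_iff]
  rw [h]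
  refine MeasurableSet.iInter fun i => ?_
  exact measurableSet_eq_fun ((measurable_pi_apply i).comp hf) ((measurable_pi_apply i).comp hg)

theorem measurable_decide {X : Type*} [MeasurableSpace X] {p : X → Prop} [DecidablePred p]
    (hp : MeasurableSet {x | p x}) : Measurable fun x => decide (p x) := by
  refine measurable_to_bool ?_
  convert hp using 1
  ext x
  simp

/-! ### Treeings -/

section Treeing

variable (S : ℕ → Equiv.Perm Cantor) (n : ℕ)

open Classical in
/-- The involution `S j` restricted to the points at which `j` is the least index of an involution
among `S 0, …, S (n - 1)` with the same value. In this way every edge of the graph gets only one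
color. -/
noncomputable def leastColor (j : Fin n) (x : Cantor) : Cantor :=
  if ∀ k < j, S k x ≠ S j x then S j x else x

open Classical in
/-- The state of a point `x`: the first `n` digits of `x`, the fixed points among the values of the
involutions at `x`, and the coincidences between these values. -/
noncomputable def involutionState (x : Cantor) :
    (Fin n → Bool) × (Fin n → Bool) × (Fin n → Fin n → Bool) :=
  (fun i => x i, fun i => decide (S i x = x), fun i k => decide (S i x = S k x))

open Classical in
/-- The least index whose involution has the same value as that of the index `i`, read off from the
state; the default value does not occur for states of points. -/
noncomputable def leastIndex (a : (Fin n → Bool) × (Fin n → Bool) × (Fin n → Fin n → Bool))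
    (l : Fin n × Bool) : Fin n :=
  if h : (Finset.univ.filter fun k => a.2.2 k l.1 = true).Nonempty then
    (Finset.univ.filter fun k => a.2.2 k l.1 = true).min' h
  else l.1

variable {S n}

theorem leastColor_of_ne {j : Fin n} {x : Cantor} (h : leastColor S n j x ≠ x) :
    leastColor S n j x = S j x ∧ ∀ k < j, S k x ≠ S j x := by
  by_cases hc : ∀ k < j, S k x ≠ S j x
  · exact ⟨if_pos hc, hc⟩
  · exact absurd (if_neg hc) h

theorem leastColor_leastColor (hS : ∀ i x, S i (S i x) = x) (j : Fin n) (x : Cantor) :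
    leastColor S n j (leastColor S n j x) = x := by
  by_cases hc : ∀ k < j, S k x ≠ S j x
  · have h1 : leastColor S n j x = S j x := if_pos hc
    have h2 : ∀ k < j, S k (S j x) ≠ S j (S j x) := by
      intro k hk e
      refine hc k hk ?_
      have h := congrArg (S k) e
      rw [hS, hS] at h
      exact h.symm
    rw [h1, leastColor, if_pos h2, hS]
  · have h1 : leastColor S n j x = x := if_neg hc
    rw [h1, h1]

theorem leastIndex_spec (x : Cantor) (l : Fin n × Bool) :
    S (leastIndex n (involutionState S n x) l) x = S l.1 x ∧
      ∀ k < leastIndex n (involutionState S n x) l, S k x ≠ S l.1 x := by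
  classical
  have h : (Finset.univ.filter fun k =>
      (involutionState S n x).2.2 k l.1 = true).Nonempty := ⟨l.1, by simp [involutionState]⟩
  rw [leastIndex, dif_pos h]
  constructor
  · simpa [involutionState] using Finset.min'_mem _ h
  · intro k hk e
    refine (Finset.min'_le _ k ?_).not_gt hk
    simpa [involutionState] using e

theorem leastColor_leastIndex (x : Cantor) (l : Fin n × Bool) :
    leastColor S n (leastIndex n (involutionState S n x) l) x = S l.1 x := by
  obtain ⟨h1, h2⟩ := leastIndex_spec (S := S) x l
  rw [leastColor, if_pos (by rwa [h1]), h1]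

theorem leastIndex_image (hS : ∀ i x, S i (S i x) = x) (x : Cantor) (i : Fin n) (b b' : Bool) :
    leastIndex n (involutionState S n (S i x)) (i, b') =
      leastIndex n (involutionState S n x) (i, b) := by
  have h : ∀ k : Fin n, S k (S i x) = S i (S i x) ↔ S k x = S i x := by
    intro k
    rw [hS]
    constructor
    · intro e
      rw [← e, hS, e]
    · intro e
      rw [← e, hS]
  have h' : ∀ k, (involutionState S n (S i x)).2.2 k i = (involutionState S n x).2.2 k i :=
    fun k => decide_eq_decide.2 (h k)
  simp only [leastIndex, h']

theorem measurePreserving_leastColor {μ : Measure Cantor} (hS : ∀ i x, S i (S i x) = x)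
    (hμ : ∀ i, MeasurePreserving (S i) μ μ) (j : Fin n) :
    MeasurePreserving (leastColor S n j) μ μ := by
  classical
  have hA : MeasurableSet {x | ∀ k < j, S k x ≠ S j x} := by
    have h : {x | ∀ k < j, S k x ≠ S j x} = ⋂ k, ⋂ (_ : k < j), {x | S k x = S j x}ᶜ := by
      ext x
      simp
    rw [h]
    exact MeasurableSet.iInter fun k => MeasurableSet.iInter fun _ =>
      (measurableSet_eq_cantor (hμ k).measurable (hμ j).measurable).compl
  have hinv : S j ⁻¹' {x | ∀ k < j, S k x ≠ S j x} = {x | ∀ k < j, S k x ≠ S j x} := by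
    ext x
    simp only [Set.mem_preimage, Set.mem_ofPred_eq, hS]
    refine forall₂_congr fun k _ => not_congr ?_
    constructor
    · intro e
      rw [← e, hS, e]
    · intro e
      rw [← e, hS]
  set A := {x | ∀ k < j, S k x ≠ S j x} with hAdef
  refine ⟨Measurable.ite hA (hμ j).measurable measurable_id, ?_⟩
  have hm : Measurable (leastColor S n j) := Measurable.ite hA (hμ j).measurable measurable_id
  ext B hB
  rw [Measure.map_apply hm hB]
  have h1 : leastColor S n j ⁻¹' B ∩ A = S j ⁻¹' (B ∩ A) := by
    rw [Set.preimage_inter, hinv]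
    ext x
    refine and_congr_left fun hx => ?_
    rw [Set.mem_preimage, show leastColor S n j x = S j x from if_pos hx]
    rfl
  have h2 : leastColor S n j ⁻¹' B \ A = B \ A := by
    ext x
    refine and_congr_left fun hx => ?_
    rw [Set.mem_preimage, show leastColor S n j x = x from if_neg hx]
  rw [← measure_inter_add_sdiff _ hA, h1, h2, (hμ j).measure_preimage (hB.inter hA).nullMeasurableSet,
    measure_inter_add_sdiff _ hA]

theorem measurable_involutionState (hS : ∀ i, Measurable (S i)) :
    Measurable (involutionState S n) := by
  classical
  refine Measurable.prodMk ?_ (Measurable.prodMk ?_ ?_)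
  · exact measurable_pi_iff.2 fun i => measurable_pi_apply _
  · exact measurable_pi_iff.2 fun i =>
      measurable_decide (measurableSet_eq_cantor (hS i) measurable_id)
  · exact measurable_pi_iff.2 fun i => measurable_pi_iff.2 fun k =>
      measurable_decide (measurableSet_eq_cantor (hS i) (hS k))

/-- In a component that is a tree the restricted involutions have no closed reduced paths: a reduced
path does not backtrack, since every edge has only one color. -/
theorem isAcyclicAt_leastColor (hS : ∀ i x, S i (S i x) = x) {x : Cantor}
    (hx : ((graphing S).connectedComponentMk x).toSimpleGraph.IsTree) (R : ℕ) :
    IsAcyclicAt id (leastColor S n) R x := by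
  intro w _ hne hred hmov hclosed
  have hadj : ∀ (j : Fin n) (y : Cantor), leastColor S n j y ≠ y →
      (graphing S).Adj (leastColor S n j y) y := by
    intro j y h
    exact (SimpleGraph.fromRel_adj _ _ _).2 ⟨h, Or.inr ⟨j, (leastColor_of_ne h).1.symm⟩⟩
  have hmem : ∀ w : List (Fin n),
      wordAct (leastColor S n) w x ∈ ((graphing S).connectedComponentMk x).supp := by
    intro w
    induction w with
    | nil => exact rfl
    | cons j w ih =>
      rw [wordAct_cons]
      by_cases h : leastColor S n j (wordAct (leastColor S n) w x) = wordAct (leastColor S n) w x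
      · rwa [h]
      · rw [SimpleGraph.ConnectedComponent.mem_supp_iff] at ih ⊢
        rw [← ih]
        exact SimpleGraph.ConnectedComponent.sound (hadj _ _ h).reachable
  let pt : List (Fin n) → ((graphing S).connectedComponentMk x).supp := fun w => ⟨_, hmem w⟩
  have key : ∀ w : List (Fin n), IsReducedWord id w → IsMovingPath (leastColor S n) w x →
      ∃ q : ((graphing S).connectedComponentMk x).toSimpleGraph.Walk (pt w) (pt []),
        q.length = w.length ∧ q.edges.IsChain (· ≠ ·) ∧
          ∀ j v, w = j :: v → q.edges.head? = some s(pt w, pt v) := by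
    intro w
    induction w with
    | nil => exact fun _ _ => ⟨.nil, rfl, List.isChain_nil, by simp⟩
    | cons j w ih =>
      intro hred hmov
      obtain ⟨q, h1, h2, h3⟩ := ih hred.tail hmov.2
      have ha : ((graphing S).connectedComponentMk x).toSimpleGraph.Adj (pt (j :: w)) (pt w) :=
        hadj j _ hmov.1
      refine ⟨.cons ha q, by simp [h1], ?_, ?_⟩
      · rw [SimpleGraph.Walk.edges_cons, List.isChain_cons]
        refine ⟨fun e he => ?_, h2⟩
        cases w with
        | nil =>
          have : q.edges = [] := List.length_eq_zero_iff.1 (by rw [q.length_edges, h1]; rfl)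
          rw [this] at he
          simp at he
        | cons k v =>
          rw [h3 k v rfl, Option.mem_def, Option.some.injEq] at he
          rw [← he]
          intro e
          have hjk : j ≠ k := (List.isChain_cons_cons.1 hred).1
          -- both edges lead to the same point from `y = T k (v x)`
          have h4 : leastColor S n j (wordAct (leastColor S n) (k :: v) x) =
              wordAct (leastColor S n) v x := by
            rcases Sym2.eq_iff.1 e with ⟨e1, _⟩ | ⟨e1, _⟩
            · exact absurd (congrArg Subtype.val e1) hmov.1
            · exact congrArg Subtype.val e1
          have h5 : leastColor S n k (wordAct (leastColor S n) (k :: v) x) =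
              wordAct (leastColor S n) v x := leastColor_leastColor hS _ _
          have hj := leastColor_of_ne hmov.1
          have hk := leastColor_of_ne (j := k) (x := wordAct (leastColor S n) (k :: v) x) (by
            rw [h5, ← h4]
            exact hmov.1)
          have h6 : S j (wordAct (leastColor S n) (k :: v) x) =
              S k (wordAct (leastColor S n) (k :: v) x) := by
            rw [← hj.1, ← hk.1, h4, h5]
          rcases lt_trichotomy j k with h | h | h
          · exact hk.2 j h h6
          · exact hjk h
          · exact hj.2 k h h6.symm
      · intro i v e
        obtain ⟨_, rfl⟩ := List.cons.inj e
        simp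
  obtain ⟨q, h1, h2, -⟩ := key w hred hmov
  have hpath := (hx.isAcyclic.isPath_iff_isChain q).2 h2
  have hpt : pt w = pt [] := Subtype.ext hclosed
  have hzero : ∀ a b (q : ((graphing S).connectedComponentMk x).toSimpleGraph.Walk a b),
      a = b → q.IsPath → q.length = 0 := by
    rintro a _ q rfl hq
    exact SimpleGraph.Walk.length_eq_zero_iff.2 (SimpleGraph.Walk.isPath_iff_nil.1 hq)
  rw [hzero _ _ q hpt hpath] at h1
  exact hne (List.length_eq_zero_iff.1 h1.symm)

theorem involutionAction_gen {Y : Type*} (S : ℕ → Equiv.Perm Y) (hS : ∀ i x, S i (S i x) = x)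
    (i : ℕ) : involutionAction S hS (involutionGen i) = S i :=
  PresentedGroup.toGroup.of _

theorem isSoficAction_involutionAction {μ : Measure Cantor} [IsProbabilityMeasure μ]
    (h : IsTreeing μ S) : IsSoficAction μ involutionGen (involutionAction S h.involutive) := by
  classical
  refine isSoficAction_of_approximations fun n ε hε => ?_
  have hS := h.involutive
  refine exists_finite_approximation μ (P := involutionState S n) (inv := id)
    (F := fun a j => (∃ k < j, a.2.2 k j = true) ∨ a.2.1 j = true) (T := leastColor S n)
    (m := leastIndex n) (ℓ := fun a => a.1) ?_ (fun _ => rfl)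
    (measurePreserving_leastColor hS h.measurePreserving) ?_ ?_ ?_ ?_ hε
  · exact fun a => measurable_involutionState (fun i => (h.measurePreserving i).measurable)
      (measurableSet_singleton a)
  · filter_upwards [h.tree] with x hx R using isAcyclicAt_leastColor hS hx R
  · refine ⟨⟨leastColor_leastColor hS, fun j x => ?_⟩, ?_, fun _ _ => rfl⟩
    · by_cases hc : ∀ k < j, S k x ≠ S j x
      · have h1 : leastColor S n j x = S j x := if_pos hc
        have h2 : ¬ ∃ k < j, S k x = S j x := by
          rintro ⟨k, hk, e⟩
          exact hc k hk e
        simp [involutionState, h1, h2]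
      · have h1 : leastColor S n j x = x := if_neg hc
        have h2 : ∃ k < j, S k x = S j x := by
          push Not at hc
          exact hc
        simp [involutionState, h1, h2]
    · intro l x
      rw [leastColor_leastIndex]
      simp only [letterAct, involutionAction_gen]
      split_ifs
      · rfl
      · rw [Equiv.symm_apply_eq, hS]
  · intro x i b
    rw [leastColor_leastIndex]
    exact leastIndex_image hS x i b _
  · intro Z s hs
    have h2 : ∀ i z, s i (s i z) = z := fun i z =>
      hs [(i, true), (i, true)] le_rfl (fun x => by simp [letterAct, involutionAction_gen, hS]) z
    refine ⟨involutionAction (fun i => if hi : i < n then s ⟨i, hi⟩ else 1) ?_, fun i => ?_⟩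
    · intro i z
      by_cases hi : i < n <;> simp [hi, h2]
    · rw [involutionAction_gen]
      simp

theorem reachableSetoid_eq_orbitSetoid {Y : Type*} (S : ℕ → Equiv.Perm Y)
    (θ : FreeGroup ℕ →* Equiv.Perm Y) (hθ : ∀ i, θ (FreeGroup.of i) = S i) :
    (graphing S).reachableSetoid = orbitSetoid θ := by
  ext x y
  constructor
  · rintro ⟨q⟩
    induction q with
    | nil => exact (orbitSetoid θ).refl _
    | cons hadj _ ih =>
      refine (orbitSetoid θ).trans ?_ ih
      rcases ((SimpleGraph.fromRel_adj _ _ _).1 hadj).2 with ⟨i, hi⟩ | ⟨i, hi⟩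
      · exact ⟨FreeGroup.of i, by rw [hθ, hi]⟩
      · exact (orbitSetoid θ).symm ⟨FreeGroup.of i, by rw [hθ, hi]⟩
  · rintro ⟨g, rfl⟩
    have hstep : ∀ i y, (graphing S).Reachable y (S i y) := by
      intro i y
      by_cases h : y = S i y
      · rw [← h]
      · exact SimpleGraph.Adj.reachable
          ((SimpleGraph.fromRel_adj _ _ _).2 ⟨h, Or.inl ⟨i, rfl⟩⟩)
    have key : ∀ (g : FreeGroup ℕ) (y : Y), (graphing S).Reachable y (θ g y) := by
      intro g
      induction g using FreeGroup.induction_on with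
      | C1 => intro y; simp
      | of i => intro y; rw [hθ]; exact hstep i y
      | inv_of i _ =>
        intro y
        have h := hstep i (θ (FreeGroup.of i)⁻¹ y)
        rw [← hθ, ← Equiv.Perm.mul_apply, ← map_mul, mul_inv_cancel, map_one] at h
        exact h.symm
      | mul a b ha hb =>
        intro y
        rw [map_mul, Equiv.Perm.mul_apply]
        exact (hb y).trans (ha _)
    exact key g x

theorem isSoficRelation_of_isTreeable {μ : Measure Cantor} [IsProbabilityMeasure μ]
    {E : Setoid Cantor} (h : IsTreeable μ E) : IsSoficRelation μ E := by
  obtain ⟨S, hS, rfl⟩ := h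
  let ψ : FreeGroup ℕ →* InvolutionGroup := FreeGroup.lift involutionGen
  have hψ : ∀ i, ψ (FreeGroup.of i) = involutionGen i := fun i => FreeGroup.lift_apply_of
  have hθ : ∀ i, (involutionAction S hS.involutive).comp ψ (FreeGroup.of i) = S i := fun i => by
    rw [MonoidHom.comp_apply, hψ, involutionAction_gen]
  refine ⟨(involutionAction S hS.involutive).comp ψ, fun g => ?_,
    reachableSetoid_eq_orbitSetoid S _ hθ, (isSoficAction_involutionAction hS).comp ψ _ hψ⟩
  induction g using FreeGroup.induction_on with
  | C1 =>
    rw [map_one]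
    exact MeasurePreserving.id μ
  | of i =>
    rw [hθ]
    exact hS.measurePreserving i
  | inv_of i _ =>
    have h : (S i)⁻¹ = S i := by
      ext1 x
      exact (Equiv.symm_apply_eq _).2 (hS.involutive i x).symm
    rw [map_inv, hθ, h]
    exact hS.measurePreserving i
  | mul a b ha hb =>
    rw [map_mul]
    exact ha.comp hb

end Treeing

/-! ### Essentially free actions of free groups -/

section Free

theorem freeGen_of_decode_none {ι : Type*} [Encodable ι] {n : ℕ}
    (h : Encodable.decode₂ ι n = none) : freeGen ι n = 1 := by
  simp [freeGen, h]

theorem freeGen_encode {ι : Type*} [Encodable ι] (a : ι) :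
    freeGen ι (Encodable.encode a) = FreeGroup.of a := by
  simp [freeGen]

/-- At a point with trivial stabilizer there are no closed reduced paths, because a reduced word in
free generators is not the trivial element. The letters without a generator move no points. -/
theorem isAcyclicAt_freeGen {ι : Type*} [Encodable ι] {Y : Type*} {θ : FreeGroup ι →* Equiv.Perm Y}
    {x : Y} (hx : ∀ g, θ g x = x → g = 1) (n R : ℕ) :
    IsAcyclicAt (fun l : Fin n × Bool => (l.1, !l.2))
      (letterAct fun i : Fin n => θ (freeGen ι i)) R x := by
  classical
  intro w hw hne hred hmov hclosed
  have hL : ∃ L : List (ι × Bool), L.map (fun q => (Encodable.encode q.1, q.2)) =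
      w.map fun q => ((q.1 : ℕ), q.2) := by
    clear hw hne hred hclosed
    induction w with
    | nil => exact ⟨[], rfl⟩
    | cons l w ih =>
      obtain ⟨L, hL⟩ := ih hmov.2
      cases hd : Encodable.decode₂ ι l.1 with
      | none =>
        refine absurd ?_ hmov.1
        simp only [letterAct, freeGen_of_decode_none hd, map_one]
        split_ifs <;> rfl
      | some a =>
        refine ⟨(a, l.2) :: L, ?_⟩
        rw [List.map_cons, List.map_cons, hL, Encodable.mem_decode₂.1 hd]
  obtain ⟨L, hL⟩ := hL
  have hLred : FreeGroup.IsReduced L := by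
    have h1 : (w.map fun q => ((q.1 : ℕ), q.2)).IsChain fun a b => a.1 = b.1 → a.2 = b.2 := by
      rw [List.isChain_map]
      refine List.IsChain.imp (fun a b hab h => ?_) hred
      by_contra h'
      exact hab (Prod.ext (Fin.ext h) (Bool.eq_not.2 h'))
    rw [← hL, List.isChain_map] at h1
    exact List.IsChain.imp (fun a b hab h => hab (congrArg Encodable.encode h)) h1
  have hmk : (w.map fun q => if q.2 then freeGen ι q.1 else (freeGen ι q.1)⁻¹).prod =
      FreeGroup.mk L := by
    have h1 : (w.map fun q => if q.2 then freeGen ι q.1 else (freeGen ι q.1)⁻¹) =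
        (w.map fun q => ((q.1 : ℕ), q.2)).map
          fun q => if q.2 then freeGen ι q.1 else (freeGen ι q.1)⁻¹ := by
      simp [Function.comp_def]
    rw [h1, ← hL, List.map_map]
    clear hL hLred h1
    induction L with
    | nil => rfl
    | cons q L ih =>
      rw [List.map_cons, List.prod_cons, ih]
      obtain ⟨a, _ | _⟩ := q
      · simp [freeGen_encode, FreeGroup.of, FreeGroup.inv_mk, FreeGroup.invRev, FreeGroup.mul_mk]
      · simp [freeGen_encode, FreeGroup.of, FreeGroup.mul_mk]
  have h1 := hx _ ((wordAct_letterAct (freeGen ι) θ w x).symm.trans hclosed)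
  rw [hmk] at h1
  have h2 : L = [] := by
    rw [← hLred.reduce_eq, ← FreeGroup.toWord_mk, h1, FreeGroup.toWord_one]
  rw [h2] at hL
  exact hne (List.map_eq_nil_iff.1 hL.symm)

open Classical in
/-- The state of a point `x` for the action of a free group: the first `n` digits of `x` and the
letters that fix `x`. -/
noncomputable def permState {n : ℕ} (s : Fin n → Equiv.Perm Cantor) (x : Cantor) :
    (Fin n → Bool) × (Fin n × Bool → Bool) :=
  (fun i => x i, fun l => decide (letterAct s l x = x))

theorem isSoficAction_freeGen {ι : Type*} [Encodable ι] {μ : Measure Cantor}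
    [IsProbabilityMeasure μ] {θ : FreeGroup ι →* Equiv.Perm Cantor}
    (hθ : ∀ g, MeasurePreserving (θ g) μ μ) (hfree : ∀ᵐ x ∂μ, ∀ g, θ g x = x → g = 1) :
    IsSoficAction μ (freeGen ι) θ := by
  classical
  refine isSoficAction_of_approximations fun n ε hε => ?_
  have hmp : ∀ l, MeasurePreserving (letterAct (fun i : Fin n => θ (freeGen ι i)) l) μ μ := by
    rintro ⟨i, _ | _⟩
    · have h := hθ (freeGen ι i)⁻¹
      rw [map_inv] at h
      exact h
    · exact hθ (freeGen ι i)
  refine exists_finite_approximation μ (P := permState fun i : Fin n => θ (freeGen ι i))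
    (inv := fun l : Fin n × Bool => (l.1, !l.2)) (F := fun a l => a.2 l = true)
    (T := letterAct fun i : Fin n => θ (freeGen ι i)) (m := fun _ l => l) (ℓ := fun a => a.1)
    ?_ (fun l => by simp) hmp ?_ ?_ (fun _ _ _ => rfl) ?_ hε
  · have hm : Measurable (permState fun i : Fin n => θ (freeGen ι i)) :=
      Measurable.prodMk (measurable_pi_iff.2 fun i => measurable_pi_apply _)
        (measurable_pi_iff.2 fun l =>
          measurable_decide (measurableSet_eq_cantor (hmp l).measurable measurable_id))
    exact fun a => hm (measurableSet_singleton a)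
  · filter_upwards [hfree] with x hx R using isAcyclicAt_freeGen hx n R
  · refine ⟨⟨?_, fun l x => by simp [permState]⟩, fun _ _ => rfl, fun _ _ => rfl⟩
    rintro ⟨i, _ | _⟩ x <;> simp [letterAct]
  · intro Z s hs
    refine ⟨FreeGroup.lift fun a =>
      if h : Encodable.encode a < n then s ⟨Encodable.encode a, h⟩ else 1, fun i => ?_⟩
    cases hd : Encodable.decode₂ ι i with
    | none =>
      rw [freeGen_of_decode_none hd, map_one]
      ext z
      refine (hs [(i, true)] (by simp) (fun x => ?_) z).symm
      simp [letterAct, freeGen_of_decode_none hd]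
    | some a =>
      have hi : Encodable.encode a = i := Encodable.mem_decode₂.1 hd
      rw [← hi, freeGen_encode, FreeGroup.lift_apply_of]
      simp [hi]

theorem isSoficRelation_freeGroup {ι : Type*} [Encodable ι] {μ : Measure Cantor}
    [IsProbabilityMeasure μ] {θ : FreeGroup ι →* Equiv.Perm Cantor}
    (hθ : ∀ g, MeasurePreserving (θ g) μ μ) (hfree : ∀ᵐ x ∂μ, ∀ g, θ g x = x → g = 1) :
    IsSoficRelation μ (orbitSetoid θ) := by
  let ψ : FreeGroup ℕ →* FreeGroup ι := FreeGroup.lift (freeGen ι)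
  have hψ : ∀ i, ψ (FreeGroup.of i) = freeGen ι i := fun i => FreeGroup.lift_apply_of
  have hsurj : Function.Surjective ψ := by
    rw [← MonoidHom.range_eq_top, eq_top_iff, ← FreeGroup.closure_range_of, Subgroup.closure_le]
    rintro _ ⟨a, rfl⟩
    exact ⟨FreeGroup.of (Encodable.encode a), by rw [hψ, freeGen_encode]⟩
  refine ⟨θ.comp ψ, fun g => hθ (ψ g), ?_, (isSoficAction_freeGen hθ hfree).comp ψ _ hψ⟩
  ext x y
  constructor
  · rintro ⟨g, hg⟩
    obtain ⟨g, rfl⟩ := hsurj g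
    exact ⟨g, hg⟩
  · rintro ⟨g, hg⟩
    exact ⟨ψ g, hg⟩

end Free

theorem theorem6p2 :
    (∀ (S : ℕ → Equiv.Perm Cantor) (hS : IsTreeing coinMeasure S),
      IsSoficAction coinMeasure involutionGen (involutionAction S hS.involutive)) ∧
    (∀ E : Setoid Cantor, IsTreeable coinMeasure E → IsSoficRelation coinMeasure E) ∧
    (∀ (ι : Type*) [Encodable ι] (θ : FreeGroup ι →* Equiv.Perm Cantor),
      (∀ g, MeasurePreserving (θ g) coinMeasure coinMeasure) →
      (∀ᵐ x ∂coinMeasure, ∀ g, θ g x = x → g = 1) →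
      IsSoficAction coinMeasure (freeGen ι) θ ∧
        IsSoficRelation coinMeasure (orbitSetoid θ)) := by
  exact ⟨fun _ hS => isSoficAction_involutionAction hS,
    fun _ hE => isSoficRelation_of_isTreeable hE,
    fun _ _ _ hθ hfree => ⟨isSoficAction_freeGen hθ hfree, isSoficRelation_freeGroup hθ hfree⟩⟩
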